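/- Let $n,p\in\mathbb N$ and $1\le L<T$, let $A\in\mathbb R^{n\times n}$, $B\in\mathbb R^{n\times p}$, $C\in\mathbb R^{p\times n}$, and consider the system $$x_{t+1}=Ax_t+Bu_t+w_t,\qquad y_t=u_t^{\mathsf T}Cx_t+z_t,\qquad x_0=0 .$$ Write $\|\cdot\|$ and $\|\cdot\|_F$ for the spectral and Frobenius norms of matrices, $\|v\|_M=\sqrt{v^{\mathsf T}Mv}$, $\operatorname{vec}$ for column-stacking vectorization, and $\otimes$ for the Kronecker product. Assume: * (Stability) the spectral radius satisfies $\rho(A)<1$. Fix any $\rho\in(\rho(A),1)$ and put $\phi(A,\rho)=\sup_{k\ge 0}\|A^k\|/\rho^k<\infty$. * (Noise) $w_0,\dots,w_T$ are i.i.d. random vectors in $\mathbb R^n$ with $\mathbb E[w_t]=0$ and finite covariance $\mathbb E[w_tw_t^{\mathsf T}]=\Sigma_w$; $z_0,\dots,z_T$ are i.i.d. real random variables with $\mathbb E[z_t]=0$ and $\mathbb E[z_t^2]=\sigma_z^2<\infty$. (No further moment or tail assumption is made.) * (Inputs) $u_0,\dots,u_T\in\mathbb R^p$ are fixed, with Euclidean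 norm $\|u_t\|\le\beta$ for all $0\le t\le T$, where $\beta>0$. Let $\bar u_t=(u_t^{\mathsf T},u_{t-1}^{\mathsf T},\dots,u_{t-L+1}^{\mathsf T})^{\mathsf T}\in\mathbb R^{pL}$, let $\tilde U\in\mathbb R^{(T-L)\times p^2L}$ be the matrix with rows $(\bar u_{t-1}\otimes u_t)^{\mathsf T}$, $t=L+1,\dots,T$, and assume $\tilde V:=\tilde U^{\mathsf T}\tilde U\succ0$. Let $$G=[\,CB,\ CAB,\ \dots,\ CA^{L-1}B\,]\in\mathbb R^{p\times pL},\qquad F=[\,C,\ CA,\ \dots,\ CA^{L-1}\,]\in\mathbb R^{p\times nL},$$ $$\hat G=\arg\min_{G'\in\mathbb R^{p\times pL}}\frac1{2(T-L)}\sum_{t=L+1}^T\big(y_t-u_t^{\mathsf T}G'\bar u_{t-1}\big)^2 ,$$ $$\Gamma_w^\infty=\sum_{i=0}^\infty A^i\Sigma_w(A^i)^{\mathsf T},\qquad \sigma_w^2=\|\Sigma_w\|\,\|F\|_F^2\Big(1+\frac{\phi(A,\rho)\rho^L}{1-\rho}\Big),$$ $$\sigma_e^2=\|\Gamma_w^\infty\|\,\|CA^L\|^2\frac{\phi(A,\rho)}{1-\rho},\qquad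 K=\max\{\|B\|,\|C\|\}.$$ Then there is an absolute constant $c>0$ (independent of all the quantities above and of $\delta$) such that, for every $\delta\in(0,1)$, with $$\kappa:=\sqrt{\frac{p^2L}{\delta}\big(\sigma_z^2+\sigma_w^2\beta^2L+\sigma_e^2\beta^2\big)}+\beta^2K^2\,\frac{\phi(A,\rho)\rho^L}{1-\rho}\sqrt{T-L},$$ we have, with probability at least $1-\delta$, $$\|\operatorname{vec}(\hat G)-\operatorname{vec}(G)\|_{\tilde V}\le c\,\kappa ,$$ and likewise, with probability at least $1-\delta$, $$\|\hat G-G\|_F\le \frac{c\,\kappa}{\sqrt{\lambda_{\min}(\tilde U^{\mathsf T}\tilde U)}} .$$ -/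

import Mathlib

open MeasureTheory ProbabilityTheory Matrix

namespace BilinearObs

noncomputable section

/-! ### Matrix norms, spectral radius, smallest eigenvalue -/

open scoped Matrix.Norms.L2Operator in
/-- The spectral norm (Euclidean operator norm) of a real matrix. -/
def opNorm {m n : Type*} [Fintype m] [Fintype n] [DecidableEq n] (M : Matrix m n ℝ) : ℝ := ‖M‖

open scoped Matrix.Norms.Frobenius in
/-- The Frobenius norm of a real matrix. -/
def frobNorm {m n : Type*} [Fintype m] [Fintype n] (M : Matrix m n ℝ) : ℝ := ‖M‖

/-- The Euclidean norm of a real vector. -/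
def euclNorm {m : Type*} [Fintype m] (v : m → ℝ) : ℝ := ‖(WithLp.toLp 2 v : EuclideanSpace ℝ m)‖

/-- The ellipsoidal norm `√(vᵀ M v)`. -/
def ellNorm {m : Type*} [Fintype m] (M : Matrix m m ℝ) (v : m → ℝ) : ℝ :=
  Real.sqrt (v ⬝ᵥ (M *ᵥ v))

/-- The spectral radius of a real square matrix: the largest modulus of its complex eigenvalues. -/
def specRadius {n : ℕ} (A : Matrix (Fin n) (Fin n) ℝ) : ENNReal :=
  spectralRadius ℂ (A.map (algebraMap ℝ ℂ))

/-- The smallest eigenvalue of a symmetric real matrix. -/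
def lambdaMin {m : Type*} [Fintype m] [DecidableEq m] (M : Matrix m m ℝ) : ℝ :=
  sInf (spectrum ℝ M)

/-- The transient response `φ(A, ρ) = sup_{k ≥ 0} ‖A ^ k‖ / ρ ^ k`
(a finite supremum as soon as `ρ` exceeds the spectral radius of `A`). -/
def transient {n : ℕ} (A : Matrix (Fin n) (Fin n) ℝ) (ρ : ℝ) : ℝ :=
  ⨆ k : ℕ, opNorm (A ^ k) / ρ ^ k

/-- The infinite-time Gramian `∑_{i ≥ 0} A ^ i Σ (A ^ i)ᵀ` (convergent for stable `A`). -/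
def gramian {n : ℕ} (A S : Matrix (Fin n) (Fin n) ℝ) : Matrix (Fin n) (Fin n) ℝ :=
  ∑' i : ℕ, A ^ i * S * (A ^ i)ᵀ

/-! ### The system -/

/-- The state trajectory `x_{t+1} = A x_t + B u_t + w_t`, `x_0 = 0`. -/
def state {n p : ℕ} (A : Matrix (Fin n) (Fin n) ℝ) (B : Matrix (Fin n) (Fin p) ℝ)
    (u : ℕ → Fin p → ℝ) (w : ℕ → Fin n → ℝ) : ℕ → Fin n → ℝ
  | 0 => 0
  | t + 1 => A *ᵥ state A B u w t + B *ᵥ u t + w t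

/-- The scalar output `y_t = u_tᵀ C x_t + z_t`. -/
def output {n p : ℕ} (A : Matrix (Fin n) (Fin n) ℝ) (B : Matrix (Fin n) (Fin p) ℝ)
    (C : Matrix (Fin p) (Fin n) ℝ) (u : ℕ → Fin p → ℝ) (w : ℕ → Fin n → ℝ) (z : ℕ → ℝ)
    (t : ℕ) : ℝ :=
  u t ⬝ᵥ (C *ᵥ state A B u w t) + z t

/-- The matrix `[CB, CAB, …, CA^{L-1}B]` of the first `L` Markov parameters; its columns are
indexed by (block, column inside the block). -/
def markovG {n p : ℕ} (A : Matrix (Fin n) (Fin n) ℝ) (B : Matrix (Fin n) (Fin p) ℝ)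
    (C : Matrix (Fin p) (Fin n) ℝ) (L : ℕ) : Matrix (Fin p) (Fin L × Fin p) ℝ :=
  Matrix.of fun i lj => (C * A ^ (lj.1 : ℕ) * B) i lj.2

/-- The matrix `F = [C, CA, …, CA^{L-1}]`. -/
def markovF {n p : ℕ} (A : Matrix (Fin n) (Fin n) ℝ) (C : Matrix (Fin p) (Fin n) ℝ) (L : ℕ) :
    Matrix (Fin p) (Fin L × Fin n) ℝ :=
  Matrix.of fun i lj => (C * A ^ (lj.1 : ℕ)) i lj.2

/-- The input history `ū_t = (u_t, u_{t-1}, …, u_{t-L+1})`, used only for `t ≥ L`. -/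
def inputHist {p : ℕ} (u : ℕ → Fin p → ℝ) (L t : ℕ) : Fin L × Fin p → ℝ :=
  fun lj => u (t - (lj.1 : ℕ)) lj.2

/-- The design matrix: row `τ = 0, …, T-L-1` is `(ū_{t-1} ⊗ u_t)ᵀ` with `t = L + 1 + τ`. -/
def design {p : ℕ} (u : ℕ → Fin p → ℝ) (L T : ℕ) :
    Matrix (Fin (T - L)) ((Fin L × Fin p) × Fin p) ℝ :=
  Matrix.of fun τ k => inputHist u L (L + τ) k.1 * u (L + 1 + τ) k.2

/-- The matrix `Ṽ = Ũᵀ Ũ`. -/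
def designGram {p : ℕ} (u : ℕ → Fin p → ℝ) (L T : ℕ) :
    Matrix ((Fin L × Fin p) × Fin p) ((Fin L × Fin p) × Fin p) ℝ :=
  (design u L T)ᵀ * design u L T

/-- The least-squares objective `1 / (2 (T - L)) ∑_{t = L+1}^T (y_t - u_tᵀ G ū_{t-1})²`. -/
def lsObjective {p : ℕ} (u : ℕ → Fin p → ℝ) (y : ℕ → ℝ) (L T : ℕ)
    (G : Matrix (Fin p) (Fin L × Fin p) ℝ) : ℝ :=
  1 / (2 * ((T : ℝ) - L)) *
    ∑ t ∈ Finset.Icc (L + 1) T, (y t - u t ⬝ᵥ (G *ᵥ inputHist u L (t - 1))) ^ 2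

/-- `G` solves the least-squares problem for inputs `u` and outputs `y`. -/
def IsLeastSquares {p : ℕ} (u : ℕ → Fin p → ℝ) (y : ℕ → ℝ) (L T : ℕ)
    (G : Matrix (Fin p) (Fin L × Fin p) ℝ) : Prop :=
  ∀ G' : Matrix (Fin p) (Fin L × Fin p) ℝ, lsObjective u y L T G ≤ lsObjective u y L T G'

/-! ### Noise -/

/-- `w_0, …, w_T` are i.i.d., centered, square integrable random vectors with covariance `S`. -/
structure IsProcessNoise {Ω : Type*} [MeasurableSpace Ω] (P : Measure Ω) {n : ℕ} (T : ℕ)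
    (w : ℕ → Ω → Fin n → ℝ) (S : Matrix (Fin n) (Fin n) ℝ) : Prop where
  indep : iIndepFun (fun t : Fin (T + 1) => w t) P
  identDistrib : ∀ t ≤ T, IdentDistrib (w t) (w 0) P P
  memLp : ∀ t ≤ T, ∀ i, MemLp (fun ω => w t ω i) 2 P
  mean : ∀ t ≤ T, ∀ i, ∫ ω, w t ω i ∂P = 0
  cov : ∀ t ≤ T, ∀ i j, ∫ ω, w t ω i * w t ω j ∂P = S i j

/-- `z_0, …, z_T` are i.i.d., centered, square integrable random variables with variance `σ²`. -/
structure IsMeasurementNoise {Ω : Type*} [MeasurableSpace Ω] (P : Measure Ω) (T : ℕ)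
    (z : ℕ → Ω → ℝ) (σ : ℝ) : Prop where
  indep : iIndepFun (fun t : Fin (T + 1) => z t) P
  identDistrib : ∀ t ≤ T, IdentDistrib (z t) (z 0) P P
  memLp : ∀ t ≤ T, MemLp (z t) 2 P
  mean : ∀ t ≤ T, ∫ ω, z t ω ∂P = 0
  var : ∀ t ≤ T, ∫ ω, z t ω ^ 2 ∂P = σ ^ 2

/-! ### The error bound -/

/-- `σ_w² = ‖Σ_w‖ ‖F‖_F² (1 + φ(A, ρ) ρ^L / (1 - ρ))`. -/
def sigmaWSq {n p : ℕ} (A : Matrix (Fin n) (Fin n) ℝ) (C : Matrix (Fin p) (Fin n) ℝ)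
    (S : Matrix (Fin n) (Fin n) ℝ) (ρ : ℝ) (L : ℕ) : ℝ :=
  opNorm S * frobNorm (markovF A C L) ^ 2 * (1 + transient A ρ * ρ ^ L / (1 - ρ))

/-- `σ_e² = ‖Γ_w^∞‖ ‖C A^L‖² φ(A, ρ) / (1 - ρ)`. -/
def sigmaESq {n p : ℕ} (A : Matrix (Fin n) (Fin n) ℝ) (C : Matrix (Fin p) (Fin n) ℝ)
    (S : Matrix (Fin n) (Fin n) ℝ) (ρ : ℝ) (L : ℕ) : ℝ :=
  opNorm (gramian A S) * opNorm (C * A ^ L) ^ 2 * (transient A ρ / (1 - ρ))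

/-- `κ = √(p² L / δ · (σ_z² + σ_w² β² L + σ_e² β²)) + β² K² φ(A, ρ) ρ^L / (1 - ρ) · √(T - L)`
with `K = max(‖B‖, ‖C‖)`. -/
def errorBound {n p : ℕ} (A : Matrix (Fin n) (Fin n) ℝ) (B : Matrix (Fin n) (Fin p) ℝ)
    (C : Matrix (Fin p) (Fin n) ℝ) (S : Matrix (Fin n) (Fin n) ℝ) (σz β ρ δ : ℝ)
    (L T : ℕ) : ℝ :=
  Real.sqrt ((p : ℝ) ^ 2 * L / δ *
      (σz ^ 2 + sigmaWSq A C S ρ L * β ^ 2 * L + sigmaESq A C S ρ L * β ^ 2)) +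
    β ^ 2 * max (opNorm B) (opNorm C) ^ 2 * (transient A ρ * ρ ^ L / (1 - ρ)) *
      Real.sqrt ((T : ℝ) - L)

end

end BilinearObs

namespace BilinearObs

/-! ### Vector and matrix norms -/

section Norms

variable {m n l : Type*} [Fintype m] [Fintype n] [Fintype l]

/-! The ellipsoidal error is the Euclidean norm of the design matrix applied to `vec Ghat - vec G`.
By optimality this vector is the orthogonal projection, onto the range of the design, of the
residual of the true parameter (`IsLeastSquares.toLp_design_eq`). Unrolling the state over `L` steps
splits that residual into a deterministic truncation bias and a centered noise vector
(`output_sub_eq`).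

Projection does not increase the bias, whose `T - L` entries are bounded uniformly by `abs_bias_le`;
this gives the second summand of `errorBound`. For the noise, the squared norm of the projection is
a sum of squared coordinates over at most `p ^ 2 * L` orthonormal directions. Its expectation is
therefore at most that dimension times a bound on the second moment in a unit direction, and
Markov's inequality produces the factor `1 / δ`. Second moments suffice.

The real work is a directional bound independent of `T` (`integral_sum_noiseResidual_sq_le`),
although the residuals at different times share process noise. Each combination of residuals is
rewritten as a combination of the independent `w s`. Recent noise enters through windows of length
`L`, handled by Cauchy–Schwarz and counting (`sum_windowWeight_quadratic_le`). Old noise enters with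
weights solving a backward recursion (`sum_tail_eq`), and the Lyapunov identity `gramian_eq`
telescopes their quadratic form (`sum_adjointState_quadratic_le`). This yields the Gramian with only
one factor `transient A ρ / (1 - ρ)`. -/

lemma euclNorm_nonneg (v : m → ℝ) : 0 ≤ euclNorm v := norm_nonneg _

lemma euclNorm_zero : euclNorm (0 : m → ℝ) = 0 := by simp [euclNorm]

lemma euclNorm_sq (v : m → ℝ) : euclNorm v ^ 2 = ∑ i, v i ^ 2 := by
  simp [euclNorm, EuclideanSpace.norm_sq_eq]

lemma dotProduct_self_eq_euclNorm_sq (v : m → ℝ) : v ⬝ᵥ v = euclNorm v ^ 2 := by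
  rw [euclNorm_sq]; simp [dotProduct, sq]

lemma euclNorm_add_le (v w : m → ℝ) : euclNorm (v + w) ≤ euclNorm v + euclNorm w := by
  simpa [euclNorm] using norm_add_le (WithLp.toLp 2 v : EuclideanSpace ℝ m) (WithLp.toLp 2 w)

lemma euclNorm_smul (a : ℝ) (v : m → ℝ) : euclNorm (a • v) = |a| * euclNorm v := by
  simp [euclNorm, norm_smul]

lemma euclNorm_sum_le {ι : Type*} (s : Finset ι) (f : ι → m → ℝ) :
    euclNorm (∑ i ∈ s, f i) ≤ ∑ i ∈ s, euclNorm (f i) := by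
  simpa [euclNorm] using norm_sum_le s fun i => (WithLp.toLp 2 (f i) : EuclideanSpace ℝ m)

lemma abs_dotProduct_le (v w : m → ℝ) : |v ⬝ᵥ w| ≤ euclNorm v * euclNorm w := by
  have h := abs_real_inner_le_norm (WithLp.toLp 2 v : EuclideanSpace ℝ m) (WithLp.toLp 2 w)
  rwa [EuclideanSpace.inner_toLp_toLp, dotProduct_comm] at h

lemma opNorm_nonneg [DecidableEq n] (M : Matrix m n ℝ) : 0 ≤ opNorm M := by
  let := Matrix.instL2OpNormedAddCommGroup (m := m) (n := n) (𝕜 := ℝ)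
  exact norm_nonneg M

lemma euclNorm_mulVec_le [DecidableEq n] (M : Matrix m n ℝ) (v : n → ℝ) :
    euclNorm (M *ᵥ v) ≤ opNorm M * euclNorm v :=
  l2_opNorm_mulVec M (WithLp.toLp 2 v)

lemma opNorm_mul_le [DecidableEq n] [DecidableEq l] (M : Matrix m n ℝ) (N : Matrix n l ℝ) :
    opNorm (M * N) ≤ opNorm M * opNorm N :=
  l2_opNorm_mul M N

lemma opNorm_transpose [DecidableEq m] [DecidableEq n] (M : Matrix m n ℝ) :
    opNorm Mᵀ = opNorm M := by
  rw [← conjTranspose_eq_transpose_of_trivial]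
  exact l2_opNorm_conjTranspose M

lemma frobNorm_nonneg (M : Matrix m n ℝ) : 0 ≤ frobNorm M := by
  let := Matrix.frobeniusSeminormedAddCommGroup (m := m) (n := n) (α := ℝ)
  exact norm_nonneg _

lemma frobNorm_sq (M : Matrix m n ℝ) : frobNorm M ^ 2 = ∑ i, ∑ j, M i j ^ 2 := by
  have h : frobNorm M = (∑ i, ∑ j, ‖M i j‖ ^ (2 : ℝ)) ^ (1 / 2 : ℝ) := frobenius_norm_def M
  rw [h, ← Real.sqrt_eq_rpow, Real.sq_sqrt]
  · simp
  · positivity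

lemma frobNorm_transpose (M : Matrix m n ℝ) : frobNorm Mᵀ = frobNorm M :=
  frobenius_norm_transpose M

lemma euclNorm_vec (M : Matrix m n ℝ) : euclNorm (Matrix.vec M) = frobNorm M := by
  rw [← sq_eq_sq₀ (euclNorm_nonneg _) (frobNorm_nonneg _), euclNorm_sq, frobNorm_sq,
    Fintype.sum_prod_type, Finset.sum_comm]
  rfl

lemma euclNorm_mulVec_le_frobNorm (M : Matrix m n ℝ) (v : n → ℝ) :
    euclNorm (M *ᵥ v) ≤ frobNorm M * euclNorm v := by
  refine le_of_sq_le_sq ?_ (mul_nonneg (frobNorm_nonneg _) (euclNorm_nonneg _))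
  rw [mul_pow, euclNorm_sq, euclNorm_sq, frobNorm_sq, Finset.sum_mul]
  exact Finset.sum_le_sum fun i _ => Finset.sum_mul_sq_le_sq_mul_sq _ _ _

lemma opNorm_le_frobNorm [DecidableEq n] (M : Matrix m n ℝ) : opNorm M ≤ frobNorm M := by
  refine ContinuousLinearMap.opNorm_le_bound _ (frobNorm_nonneg _) fun x => ?_
  exact euclNorm_mulVec_le_frobNorm M (WithLp.ofLp x)

lemma abs_dotProduct_mulVec_le [DecidableEq n] (M : Matrix m n ℝ) (v : m → ℝ) (w : n → ℝ) :
    |v ⬝ᵥ (M *ᵥ w)| ≤ opNorm M * (euclNorm v * euclNorm w) := by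
  calc |v ⬝ᵥ (M *ᵥ w)| ≤ euclNorm v * euclNorm (M *ᵥ w) := abs_dotProduct_le _ _
    _ ≤ euclNorm v * (opNorm M * euclNorm w) :=
        mul_le_mul_of_nonneg_left (euclNorm_mulVec_le _ _) (euclNorm_nonneg _)
    _ = _ := by ring

lemma abs_apply_le_opNorm [DecidableEq m] [DecidableEq n] (M : Matrix m n ℝ) (i : m) (j : n) :
    |M i j| ≤ opNorm M := by
  have h := abs_dotProduct_mulVec_le M (Pi.single i 1) (Pi.single j 1)
  simpa [euclNorm] using h

end Norms

/-! ### The smallest eigenvalue -/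

section LambdaMin

variable {m : Type*} [Fintype m] [DecidableEq m] {M : Matrix m m ℝ}

lemma lambdaMin_mem_spectrum [Nonempty m] (hM : M.IsHermitian) : lambdaMin M ∈ spectrum ℝ M := by
  unfold lambdaMin
  rw [hM.spectrum_real_eq_range_eigenvalues]
  exact (Set.range_nonempty _).csInf_mem (Set.finite_range _)

lemma lambdaMin_pos [Nonempty m] (hM : M.PosDef) : 0 < lambdaMin M := by
  have h := lambdaMin_mem_spectrum hM.isHermitian
  rw [hM.isHermitian.spectrum_real_eq_range_eigenvalues] at h
  obtain ⟨i, hi⟩ := h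
  rw [← hi]
  exact hM.eigenvalues_pos i

/-- Subtracting `lambdaMin M` times the identity shifts the spectrum into the nonnegative reals, so
the difference is positive semidefinite. -/
lemma lambdaMin_mul_sq_le (hM : M.IsHermitian) (v : m → ℝ) :
    lambdaMin M * euclNorm v ^ 2 ≤ v ⬝ᵥ (M *ᵥ v) := by
  have hpsd : (M - algebraMap ℝ (Matrix m m ℝ) (lambdaMin M)).PosSemidef := by
    rw [posSemidef_iff_isHermitian_and_spectrum_nonneg]
    refine ⟨hM.sub ?_, fun x hx => ?_⟩
    · simp [IsHermitian, algebraMap_eq_diagonal]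
    · rw [← spectrum.sub_singleton_eq] at hx
      obtain ⟨a, ha, b, hb, rfl⟩ := hx
      rw [Set.mem_singleton_iff] at hb
      subst hb
      have hfin : (spectrum ℝ M).Finite := by
        rw [hM.spectrum_real_eq_range_eigenvalues]; exact Set.finite_range _
      exact sub_nonneg.2 (csInf_le hfin.bddBelow ha)
  have h := hpsd.dotProduct_mulVec_nonneg v
  rw [Algebra.algebraMap_eq_smul_one, star_trivial, sub_mulVec, dotProduct_sub, smul_mulVec,
    one_mulVec, dotProduct_smul, dotProduct_self_eq_euclNorm_sq, smul_eq_mul] at h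
  linarith

end LambdaMin

/-! ### The transient response -/

section Transient

variable {n : ℕ} {A : Matrix (Fin n) (Fin n) ℝ} {ρ : ℝ}

lemma pos_of_specRadius_lt (h : specRadius A < ENNReal.ofReal ρ) : 0 < ρ :=
  ENNReal.ofReal_pos.1 (bot_le.trans_lt h)

open scoped Matrix.Norms.Operator in
-- Gelfand's formula for the complexified matrix. The norm here is the row-sum operator norm; any
-- submultiplicative norm would do, since `bddAbove_transient` passes through entries to return to
-- `opNorm`.
lemma eventually_norm_map_pow_le (h : specRadius A < ENNReal.ofReal ρ) :
    ∀ᶠ k : ℕ in Filter.atTop, ‖(A.map (algebraMap ℝ ℂ)) ^ k‖ ≤ ρ ^ k := by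
  have hρ := pos_of_specRadius_lt h
  have ht := spectrum.pow_nnnorm_pow_one_div_tendsto_nhds_spectralRadius (A.map (algebraMap ℝ ℂ))
  filter_upwards [ht.eventually (gt_mem_nhds h), Filter.eventually_gt_atTop 0] with k hk hk0
  have h1 := ENNReal.rpow_le_rpow hk.le (Nat.cast_nonneg k : (0 : ℝ) ≤ k)
  rw [← ENNReal.rpow_mul, one_div_mul_cancel (by positivity), ENNReal.rpow_one,
    ENNReal.rpow_natCast, ← ENNReal.ofReal_pow hρ.le, ← ENNReal.ofReal_coe_nnreal,
    ENNReal.ofReal_le_ofReal_iff (by positivity)] at h1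
  simpa using h1

open scoped Matrix.Norms.Operator in
lemma abs_apply_le_norm_map (M : Matrix (Fin n) (Fin n) ℝ) (i j : Fin n) :
    |M i j| ≤ ‖M.map (algebraMap ℝ ℂ)‖ := by
  have h1 : ‖M.map (algebraMap ℝ ℂ) i j‖₊ ≤ ∑ j', ‖M.map (algebraMap ℝ ℂ) i j'‖₊ :=
    Finset.single_le_sum (f := fun j' => ‖M.map (algebraMap ℝ ℂ) i j'‖₊) (fun _ _ => zero_le)
      (Finset.mem_univ j)
  have h2 : ∑ j', ‖M.map (algebraMap ℝ ℂ) i j'‖₊ ≤ ‖M.map (algebraMap ℝ ℂ)‖₊ := by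
    rw [linfty_opNNNorm_def]
    exact Finset.le_sup (f := fun i => ∑ j', ‖M.map (algebraMap ℝ ℂ) i j'‖₊) (Finset.mem_univ i)
  have h3 : ‖M.map (algebraMap ℝ ℂ) i j‖ ≤ ‖M.map (algebraMap ℝ ℂ)‖ := h1.trans h2
  simpa using h3

lemma frobNorm_le_of_abs_apply_le {M : Matrix (Fin n) (Fin n) ℝ} {a : ℝ} (ha : 0 ≤ a)
    (h : ∀ i j, |M i j| ≤ a) : frobNorm M ≤ n * a := by
  refine le_of_sq_le_sq ?_ (by positivity)
  rw [frobNorm_sq]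
  calc ∑ i, ∑ j, M i j ^ 2 ≤ ∑ _i : Fin n, ∑ _j : Fin n, a ^ 2 :=
        Finset.sum_le_sum fun i _ => Finset.sum_le_sum fun j _ => sq_le_sq' (abs_le.1 (h i j)).1
          (abs_le.1 (h i j)).2
    _ = (n * a) ^ 2 := by simp; ring

lemma bddAbove_transient (h : specRadius A < ENNReal.ofReal ρ) :
    BddAbove (Set.range fun k : ℕ => opNorm (A ^ k) / ρ ^ k) := by
  have hρ := pos_of_specRadius_lt h
  refine Filter.IsBoundedUnder.bddAbove_range (Filter.isBoundedUnder_of_eventually_le (a := (n : ℝ)) ?_)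
  filter_upwards [eventually_norm_map_pow_le h] with k hk
  rw [div_le_iff₀ (by positivity)]
  refine (opNorm_le_frobNorm _).trans (frobNorm_le_of_abs_apply_le (by positivity) fun i j => ?_)
  refine (abs_apply_le_norm_map _ i j).trans ?_
  have : (A ^ k).map (algebraMap ℝ ℂ) = (A.map (algebraMap ℝ ℂ)) ^ k :=
    map_pow (algebraMap ℝ ℂ).mapMatrix A k
  rwa [this]

lemma transient_nonneg (hρ : 0 < ρ) : 0 ≤ transient A ρ :=
  Real.iSup_nonneg fun k => div_nonneg (opNorm_nonneg _) (by positivity)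

lemma opNorm_pow_le (h : specRadius A < ENNReal.ofReal ρ) (k : ℕ) :
    opNorm (A ^ k) ≤ transient A ρ * ρ ^ k := by
  have hρ := pos_of_specRadius_lt h
  rw [← div_le_iff₀ (by positivity)]
  exact le_ciSup (bddAbove_transient h) k

end Transient

/-! ### The Gramian -/

section Gramian

variable {n : ℕ} {A S : Matrix (Fin n) (Fin n) ℝ} {ρ : ℝ}

lemma summable_gramian (h : specRadius A < ENNReal.ofReal ρ) (hρ1 : ρ < 1) :
    Summable fun i : ℕ => A ^ i * S * (A ^ i)ᵀ := by
  have hρ := pos_of_specRadius_lt h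
  refine Pi.summable.2 fun i => Pi.summable.2 fun j => ?_
  have hg : Summable fun k : ℕ => transient A ρ ^ 2 * opNorm S * (ρ ^ 2) ^ k :=
    (summable_geometric_of_lt_one (by positivity) (by nlinarith)).mul_left _
  refine Summable.of_norm_bounded hg fun k => ?_
  rw [Real.norm_eq_abs]
  have h0 := transient_nonneg (A := A) hρ
  calc |(A ^ k * S * (A ^ k)ᵀ) i j| ≤ opNorm (A ^ k * S * (A ^ k)ᵀ) := abs_apply_le_opNorm _ _ _
    _ ≤ opNorm (A ^ k) * opNorm S * opNorm (A ^ k) := by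
        refine (opNorm_mul_le _ _).trans ?_
        rw [opNorm_transpose]
        exact mul_le_mul_of_nonneg_right (opNorm_mul_le _ _) (opNorm_nonneg _)
    _ ≤ (transient A ρ * ρ ^ k) * opNorm S * (transient A ρ * ρ ^ k) := by
        have := opNorm_pow_le h k
        have := opNorm_nonneg S
        have := opNorm_nonneg (A ^ k)
        gcongr
    _ = _ := by ring

/-- The discrete Lyapunov equation: split off the term `i = 0` and factor `A` and `Aᵀ` out of the
rest. -/
lemma gramian_eq (h : specRadius A < ENNReal.ofReal ρ) (hρ1 : ρ < 1) :
    gramian A S = S + A * gramian A S * Aᵀ := by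
  have hs := summable_gramian (S := S) h hρ1
  unfold gramian
  have hc : A * (∑' i : ℕ, A ^ i * S * (A ^ i)ᵀ) * Aᵀ
      = ∑' i : ℕ, A * (A ^ i * S * (A ^ i)ᵀ) * Aᵀ := by
    rw [← hs.tsum_mul_left A, ← (hs.mul_left A).tsum_mul_right]
  rw [hc, hs.tsum_eq_zero_add]
  simp [pow_succ', Matrix.mul_assoc]

lemma hasSum_dotProduct_gramian (h : specRadius A < ENNReal.ofReal ρ) (hρ1 : ρ < 1)
    (v w : Fin n → ℝ) :
    HasSum (fun i : ℕ => v ⬝ᵥ ((A ^ i * S * (A ^ i)ᵀ) *ᵥ w)) (v ⬝ᵥ (gramian A S *ᵥ w)) := by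
  have hs := (summable_gramian (S := S) h hρ1).hasSum
  have := hs.map (AddMonoidHom.mk' (fun M : Matrix (Fin n) (Fin n) ℝ => v ⬝ᵥ (M *ᵥ w))
    fun M N => by simp [add_mulVec]) (by
      change Continuous fun M : Matrix (Fin n) (Fin n) ℝ => v ⬝ᵥ (M *ᵥ w)
      fun_prop)
  exact this

lemma dotProduct_conj_mulVec (M N : Matrix (Fin n) (Fin n) ℝ) (v w : Fin n → ℝ) :
    v ⬝ᵥ ((M * N * Mᵀ) *ᵥ w) = (Mᵀ *ᵥ v) ⬝ᵥ (N *ᵥ (Mᵀ *ᵥ w)) := by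
  rw [← mulVec_mulVec, ← mulVec_mulVec, dotProduct_mulVec, mulVec_transpose M v]

lemma gramian_nonneg (h : specRadius A < ENNReal.ofReal ρ) (hρ1 : ρ < 1)
    (hS : ∀ v, 0 ≤ v ⬝ᵥ (S *ᵥ v)) (v : Fin n → ℝ) : 0 ≤ v ⬝ᵥ (gramian A S *ᵥ v) :=
  (hasSum_dotProduct_gramian h hρ1 v v).nonneg fun i => by
    rw [dotProduct_conj_mulVec]; exact hS _

lemma gramian_comm (h : specRadius A < ENNReal.ofReal ρ) (hρ1 : ρ < 1)
    (hS : Sᵀ = S) (v w : Fin n → ℝ) :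
    v ⬝ᵥ (gramian A S *ᵥ w) = w ⬝ᵥ (gramian A S *ᵥ v) := by
  refine (hasSum_dotProduct_gramian h hρ1 v w).unique ?_
  convert hasSum_dotProduct_gramian h hρ1 w v using 2 with i
  rw [dotProduct_conj_mulVec, dotProduct_conj_mulVec, dotProduct_mulVec, ← mulVec_transpose, hS,
    dotProduct_comm]

end Gramian

/-! ### Weighted sums along a trajectory -/

section Sums

/-- The substitution `m = s + i`. Vanishing below `L` makes the truncated subtraction harmless,
since `m < i` forces `m < L`; vanishing from `T` on removes the overshoot. -/
lemma sum_range_sub_eq_sum_range_add {L T i : ℕ} (hi : i ≤ L) (hLT : L ≤ T) (F : ℕ → ℕ → ℝ)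
    (hF : ∀ m s, m < L ∨ T ≤ m → F m s = 0) :
    ∑ m ∈ Finset.range T, F m (m - i) = ∑ s ∈ Finset.range T, F (s + i) s := by
  obtain ⟨k, rfl⟩ := Nat.exists_eq_add_of_le (hi.trans hLT)
  have h1 : ∑ m ∈ Finset.range (i + k), F m (m - i) = ∑ s ∈ Finset.range k, F (s + i) s := by
    rw [Finset.sum_range_add, Finset.sum_eq_zero, zero_add]
    · exact Finset.sum_congr rfl fun s _ => by rw [Nat.add_sub_cancel_left, add_comm]
    · intro m hm
      exact hF _ _ (Or.inl ((Finset.mem_range.1 hm).trans_le hi))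
  rw [h1, add_comm i k, Finset.sum_range_add]
  simp only [left_eq_add]
  exact Finset.sum_eq_zero fun s _ => hF _ _ (Or.inr (by omega))

/-- Cauchy–Schwarz inside each window leaves `∑ i, b (s + i) ^ 2`; summed over `s`, each of the `L`
shifts contributes the full energy of `b`, whence the factor `L`. -/
lemma sum_sq_euclNorm_window_le {n L T : ℕ} (hLT : L ≤ T) (b : ℕ → ℝ)
    (hb : ∀ m, m < L ∨ T ≤ m → b m = 0) (H : ℕ → ℕ → Fin n → ℝ) (h : ℕ → ℝ)
    (hH : ∀ m i, m < T → i < L → euclNorm (H m i) ≤ h i) :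
    ∑ s ∈ Finset.range T, euclNorm (∑ i ∈ Finset.range L, b (s + i) • H (s + i) i) ^ 2
      ≤ L * (∑ i ∈ Finset.range L, h i ^ 2) * ∑ m ∈ Finset.range T, b m ^ 2 := by
  have key : ∀ s ∈ Finset.range T,
      euclNorm (∑ i ∈ Finset.range L, b (s + i) • H (s + i) i) ^ 2
        ≤ (∑ i ∈ Finset.range L, h i ^ 2) * ∑ i ∈ Finset.range L, b (s + i) ^ 2 := by
    intro s _
    have h1 : euclNorm (∑ i ∈ Finset.range L, b (s + i) • H (s + i) i)
        ≤ ∑ i ∈ Finset.range L, h i * |b (s + i)| := by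
      refine (euclNorm_sum_le _ _).trans (Finset.sum_le_sum fun i hi => ?_)
      rw [euclNorm_smul, mul_comm]
      by_cases hm : s + i < T
      · exact mul_le_mul_of_nonneg_right (hH _ _ hm (Finset.mem_range.1 hi)) (abs_nonneg _)
      · simp [hb (s + i) (Or.inr (not_lt.1 hm))]
    calc _ ≤ (∑ i ∈ Finset.range L, h i * |b (s + i)|) ^ 2 :=
          pow_le_pow_left₀ (euclNorm_nonneg _) h1 2
      _ ≤ (∑ i ∈ Finset.range L, h i ^ 2) * ∑ i ∈ Finset.range L, |b (s + i)| ^ 2 :=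
          Finset.sum_mul_sq_le_sq_mul_sq _ _ _
      _ = _ := by simp
  refine (Finset.sum_le_sum key).trans (le_of_eq ?_)
  rw [← Finset.mul_sum, Finset.sum_comm]
  have : ∀ i ∈ Finset.range L,
      ∑ s ∈ Finset.range T, b (s + i) ^ 2 = ∑ m ∈ Finset.range T, b m ^ 2 := fun i hi =>
    (sum_range_sub_eq_sum_range_add (Finset.mem_range.1 hi).le hLT (fun m _ => b m ^ 2)
      fun m _ hm => by simp [hb m hm]).symm
  rw [Finset.sum_congr rfl this]
  simp
  ring

/-- For each lag `k`, the autocorrelation of `|b|` is at most its energy, by the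
arithmetic–geometric mean inequality; the weights `ρ ^ k` then sum to at most `1 / (1 - ρ)`. -/
lemma sum_mul_geometric_convolution_le {ρ : ℝ} (hρ : 0 ≤ ρ) (hρ1 : ρ < 1) {N : ℕ} (b : ℕ → ℝ)
    (hb : ∀ m, N ≤ m → b m = 0) :
    ∑ j ∈ Finset.range N, |b j| * ∑ k ∈ Finset.range N, ρ ^ k * |b (j + k)|
      ≤ 1 / (1 - ρ) * ∑ j ∈ Finset.range N, b j ^ 2 := by
  have hshift : ∀ k ∈ Finset.range N,
      ∑ j ∈ Finset.range N, b (j + k) ^ 2 ≤ ∑ j ∈ Finset.range N, b j ^ 2 := by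
    intro k hk
    have h1 : ∑ j ∈ Finset.range N, b (j + k) ^ 2 = ∑ j ∈ Finset.range (N - k), b (k + j) ^ 2 := by
      obtain ⟨r, rfl⟩ := Nat.exists_eq_add_of_le (Finset.mem_range.1 hk).le
      rw [add_comm k r, Finset.sum_range_add, Nat.add_sub_cancel]
      simp only [add_comm k, add_eq_left]
      exact Finset.sum_eq_zero fun s _ => by rw [hb _ (by omega)]; simp
    obtain ⟨r, rfl⟩ := Nat.exists_eq_add_of_le (Finset.mem_range.1 hk).le
    rw [h1, Finset.sum_range_add, Nat.add_sub_cancel_left]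
    simp only [le_add_iff_nonneg_left]
    positivity
  simp only [Finset.mul_sum]
  rw [Finset.sum_comm]
  have hinner : ∀ k ∈ Finset.range N, ∑ j ∈ Finset.range N, |b j| * (ρ ^ k * |b (j + k)|)
      ≤ ρ ^ k * ∑ j ∈ Finset.range N, b j ^ 2 := by
    intro k hk
    calc ∑ j ∈ Finset.range N, |b j| * (ρ ^ k * |b (j + k)|)
        = ρ ^ k * ∑ j ∈ Finset.range N, |b j| * |b (j + k)| := by
          rw [Finset.mul_sum]; exact Finset.sum_congr rfl fun j _ => by ring
      _ ≤ ρ ^ k * ∑ j ∈ Finset.range N, (b j ^ 2 / 2 + b (j + k) ^ 2 / 2) := by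
          gcongr with j _
          nlinarith [sq_nonneg (|b j| - |b (j + k)|), sq_abs (b j), sq_abs (b (j + k))]
      _ ≤ ρ ^ k * ∑ j ∈ Finset.range N, b j ^ 2 := by
          refine mul_le_mul_of_nonneg_left ?_ (by positivity)
          rw [Finset.sum_add_distrib, ← Finset.sum_div, ← Finset.sum_div]
          linarith [hshift k hk]
  refine (Finset.sum_le_sum hinner).trans ?_
  rw [← Finset.sum_mul, ← Finset.mul_sum]
  refine mul_le_mul_of_nonneg_right ?_ (by positivity)
  rw [one_div, ← tsum_geometric_of_lt_one hρ hρ1]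
  exact (summable_geometric_of_lt_one hρ hρ1).sum_le_tsum _ fun _ _ => by positivity

end Sums

/-! ### The backward (adjoint) recursion -/

section Adjoint

variable {n : ℕ} {A S : Matrix (Fin n) (Fin n) ℝ} {ρ : ℝ}

/-- The solution of `g_j = b_j d_j + Aᵀ g_{j+1}`, `g_N = 0`, when `b` vanishes from `N` on. -/
def adjointState (A : Matrix (Fin n) (Fin n) ℝ) (N : ℕ) (b : ℕ → ℝ) (d : ℕ → Fin n → ℝ)
    (j : ℕ) : Fin n → ℝ :=
  ∑ k ∈ Finset.range N, b (j + k) • ((A ^ k)ᵀ *ᵥ d (j + k))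

variable {N : ℕ} {b : ℕ → ℝ} {d : ℕ → Fin n → ℝ}

lemma transpose_mulVec_adjointState (j : ℕ) :
    Aᵀ *ᵥ adjointState A N b d (j + 1)
      = ∑ k ∈ Finset.range N, b (j + (k + 1)) • ((A ^ (k + 1))ᵀ *ᵥ d (j + (k + 1))) := by
  unfold adjointState
  rw [mulVec_sum]
  refine Finset.sum_congr rfl fun k _ => ?_
  rw [mulVec_smul, mulVec_mulVec, ← transpose_mul, ← pow_succ, add_assoc, add_comm 1 k]

lemma adjointState_eq_of_le (hb : ∀ m, N ≤ m → b m = 0) {j : ℕ} (hj : N ≤ j) :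
    adjointState A N b d j = 0 :=
  Finset.sum_eq_zero fun k _ => by rw [hb _ (by omega), zero_smul]

lemma adjointState_eq (hb : ∀ m, N ≤ m → b m = 0) (j : ℕ) :
    adjointState A N b d j = b j • d j + Aᵀ *ᵥ adjointState A N b d (j + 1) := by
  rw [transpose_mulVec_adjointState]
  have h := Finset.sum_range_succ' (fun k => b (j + k) • ((A ^ k)ᵀ *ᵥ d (j + k))) N
  rw [Finset.sum_range_succ, hb (j + N) (by omega), zero_smul, add_zero] at h
  unfold adjointState
  rw [h, add_comm]
  simp

lemma euclNorm_smul_pow_le (h : specRadius A < ENNReal.ofReal ρ) {D : ℝ}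
    (hb : ∀ m, N ≤ m → b m = 0) (hd : ∀ m < N, euclNorm (d m) ≤ D) (j k : ℕ) :
    euclNorm (b (j + k) • ((A ^ k)ᵀ *ᵥ d (j + k))) ≤ transient A ρ * D * (ρ ^ k * |b (j + k)|) := by
  have hρ := pos_of_specRadius_lt h
  have hφ := transient_nonneg (A := A) hρ
  by_cases hm : j + k < N
  · rw [euclNorm_smul]
    calc |b (j + k)| * euclNorm ((A ^ k)ᵀ *ᵥ d (j + k))
        ≤ |b (j + k)| * (opNorm (A ^ k) * euclNorm (d (j + k))) := by
          rw [← opNorm_transpose]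
          exact mul_le_mul_of_nonneg_left (euclNorm_mulVec_le _ _) (abs_nonneg _)
      _ ≤ |b (j + k)| * ((transient A ρ * ρ ^ k) * D) := by
          have := hd _ hm
          have := opNorm_pow_le h k
          have := euclNorm_nonneg (d (j + k))
          gcongr
      _ = _ := by ring
  · simp [hb _ (not_lt.1 hm), euclNorm_zero]

lemma euclNorm_adjointState_le (h : specRadius A < ENNReal.ofReal ρ) {D : ℝ}
    (hb : ∀ m, N ≤ m → b m = 0) (hd : ∀ m < N, euclNorm (d m) ≤ D) (j : ℕ) :
    euclNorm (adjointState A N b d j)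
      ≤ transient A ρ * D * ∑ k ∈ Finset.range N, ρ ^ k * |b (j + k)| := by
  rw [Finset.mul_sum]
  exact (euclNorm_sum_le _ _).trans
    (Finset.sum_le_sum fun k _ => euclNorm_smul_pow_le h hb hd j k)

/-- Up to reindexing, this vector is the sum defining `adjointState A N b d j` without its `k = 0`
term, so the same bound holds with no additional factor of `transient A ρ`. -/
lemma euclNorm_transpose_mulVec_adjointState_le (h : specRadius A < ENNReal.ofReal ρ) {D : ℝ}
    (hD : 0 ≤ D) (hb : ∀ m, N ≤ m → b m = 0) (hd : ∀ m < N, euclNorm (d m) ≤ D) (j : ℕ) :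
    euclNorm (Aᵀ *ᵥ adjointState A N b d (j + 1))
      ≤ transient A ρ * D * ∑ k ∈ Finset.range N, ρ ^ k * |b (j + k)| := by
  have hρ := pos_of_specRadius_lt h
  have hφ := transient_nonneg (A := A) hρ
  have hs := Finset.sum_range_succ' (fun k => ρ ^ k * |b (j + k)|) N
  rw [Finset.sum_range_succ, hb (j + N) (by omega), abs_zero, mul_zero, add_zero] at hs
  rw [transpose_mulVec_adjointState]
  calc _ ≤ ∑ k ∈ Finset.range N,
        transient A ρ * D * (ρ ^ (k + 1) * |b (j + (k + 1))|) :=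
      (euclNorm_sum_le _ _).trans
        (Finset.sum_le_sum fun k _ => euclNorm_smul_pow_le h hb hd j (k + 1))
    _ ≤ _ := by
      rw [← Finset.mul_sum]
      refine mul_le_mul_of_nonneg_left ?_ (by positivity)
      rw [hs]
      exact le_add_of_nonneg_right (by positivity)

/-- Bounding `S` and each `g j` separately would cost `transient A ρ ^ 2`. Using the Lyapunov
equation and the backward recursion together, the quadratic form telescopes up to cross terms linear
in the adjoint state, which cost one factor only. -/
lemma sum_adjointState_quadratic_le (h : specRadius A < ENNReal.ofReal ρ) (hρ1 : ρ < 1)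
    (hST : Sᵀ = S) (hS : ∀ v, 0 ≤ v ⬝ᵥ (S *ᵥ v)) {D : ℝ} (hD : 0 ≤ D)
    (hb : ∀ m, N ≤ m → b m = 0) (hd : ∀ m < N, euclNorm (d m) ≤ D) :
    ∑ j ∈ Finset.range N, adjointState A N b d j ⬝ᵥ (S *ᵥ adjointState A N b d j)
      ≤ 2 * (opNorm (gramian A S) * D ^ 2 * (transient A ρ / (1 - ρ)))
        * ∑ j ∈ Finset.range N, b j ^ 2 := by
  have hρ := pos_of_specRadius_lt h
  have hφ := transient_nonneg (A := A) hρ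
  set g := adjointState A N b d with hg
  set Γ := gramian A S with hΓ
  set q : ℕ → ℝ := fun j => (Aᵀ *ᵥ g j) ⬝ᵥ (Γ *ᵥ (Aᵀ *ᵥ g j)) with hq
  -- Evaluate the `Γ`-form at `g j` twice: by `Γ = S + A Γ Aᵀ`, and by `g j = b j • d j + Aᵀ g (j +
  -- 1)`. Symmetry of `Γ` merges the two mixed terms.
  have hstep : ∀ j, g j ⬝ᵥ (S *ᵥ g j)
      = (q (j + 1) - q j) + b j * (d j ⬝ᵥ (Γ *ᵥ (g j + Aᵀ *ᵥ g (j + 1)))) := by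
    intro j
    have e1 : g j ⬝ᵥ (Γ *ᵥ g j) = g j ⬝ᵥ (S *ᵥ g j) + q j := by
      conv_lhs => rw [hΓ, gramian_eq h hρ1, add_mulVec, dotProduct_add, dotProduct_conj_mulVec]
    have e2 : g j = b j • d j + Aᵀ *ᵥ g (j + 1) := adjointState_eq hb j
    have e3 : g j ⬝ᵥ (Γ *ᵥ g j) = q (j + 1) + b j * (d j ⬝ᵥ (Γ *ᵥ (g j + Aᵀ *ᵥ g (j + 1)))) := by
      have e4 := gramian_comm (v := d j) (w := Aᵀ *ᵥ g (j + 1)) h hρ1 hST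
      rw [← hΓ] at e4
      rw [e2]
      simp only [mulVec_add, mulVec_smul, dotProduct_add, add_dotProduct, smul_dotProduct,
        dotProduct_smul, smul_eq_mul, hq]
      rw [e4]
      ring
    linarith
  have hterm : ∀ j ∈ Finset.range N, b j * (d j ⬝ᵥ (Γ *ᵥ (g j + Aᵀ *ᵥ g (j + 1))))
      ≤ 2 * (opNorm Γ * D ^ 2 * transient A ρ) *
        (|b j| * ∑ k ∈ Finset.range N, ρ ^ k * |b (j + k)|) := by
    intro j hj
    set s := ∑ k ∈ Finset.range N, ρ ^ k * |b (j + k)| with hs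
    have hs0 : 0 ≤ s := Finset.sum_nonneg fun k _ => by positivity
    have hn : euclNorm (g j + Aᵀ *ᵥ g (j + 1)) ≤ 2 * (transient A ρ * D * s) := by
      have h1 := euclNorm_adjointState_le h hb hd j
      have h2 := euclNorm_transpose_mulVec_adjointState_le h hD hb hd j
      have h3 := euclNorm_add_le (g j) (Aᵀ *ᵥ g (j + 1))
      linarith
    calc _ ≤ |b j * (d j ⬝ᵥ (Γ *ᵥ (g j + Aᵀ *ᵥ g (j + 1))))| := le_abs_self _
      _ = |b j| * |d j ⬝ᵥ (Γ *ᵥ (g j + Aᵀ *ᵥ g (j + 1)))| := abs_mul _ _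
      _ ≤ |b j| * (opNorm Γ * (euclNorm (d j) * euclNorm (g j + Aᵀ *ᵥ g (j + 1)))) :=
          mul_le_mul_of_nonneg_left (abs_dotProduct_mulVec_le _ _ _) (abs_nonneg _)
      _ ≤ |b j| * (opNorm Γ * (D * (2 * (transient A ρ * D * s)))) := by
          have := hd j (Finset.mem_range.1 hj)
          have := opNorm_nonneg Γ
          have := euclNorm_nonneg (g j + Aᵀ *ᵥ g (j + 1))
          gcongr
      _ = _ := by ring
  have hqN : q N = 0 := by
    simp [hq, hg, adjointState_eq_of_le hb le_rfl]
  -- The telescoped sum is `q N - q 0` with `q N = 0`, so it is nonpositive and may be dropped.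
  have hq0 : 0 ≤ q 0 := gramian_nonneg h hρ1 hS _
  rw [Finset.sum_congr rfl fun j _ => hstep j, Finset.sum_add_distrib, Finset.sum_range_sub, hqN]
  have h1 := Finset.sum_le_sum hterm
  rw [← Finset.mul_sum] at h1
  have h2 := mul_le_mul_of_nonneg_left (sum_mul_geometric_convolution_le hρ.le hρ1 b hb)
    (by have := opNorm_nonneg Γ; positivity : 0 ≤ 2 * (opNorm Γ * D ^ 2 * transient A ρ))
  refine le_trans (by linarith) (h2.trans (le_of_eq ?_))
  ring

end Adjoint

/-! ### The system -/

section System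

variable {n p : ℕ} (A : Matrix (Fin n) (Fin n) ℝ) (B : Matrix (Fin n) (Fin p) ℝ)
  (C : Matrix (Fin p) (Fin n) ℝ) (u : ℕ → Fin p → ℝ) (w : ℕ → Fin n → ℝ)

lemma state_add (s L : ℕ) :
    state A B u w (s + L) = A ^ L *ᵥ state A B u w s
      + ∑ i ∈ Finset.range L, A ^ i *ᵥ (B *ᵥ u (s + L - 1 - i) + w (s + L - 1 - i)) := by
  induction L with
  | zero => simp
  | succ L ih =>
    rw [Finset.sum_range_succ', ← add_assoc, state, ih, mulVec_add, mulVec_mulVec, ← pow_succ',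
      mulVec_sum]
    simp only [mulVec_mulVec, ← pow_succ', pow_zero, one_mulVec]
    have : ∀ i, s + L - 1 - i = s + L - (i + 1) := fun i => by omega
    simp only [Nat.add_sub_cancel, Nat.sub_zero, this]
    abel

lemma state_eq_sum (s : ℕ) :
    state A B u w s = ∑ i ∈ Finset.range s, A ^ i *ᵥ (B *ᵥ u (s - 1 - i) + w (s - 1 - i)) := by
  simpa [state] using state_add A B u w 0 s

lemma state_eq_add (t : ℕ) : state A B u w t = state A B u 0 t + state A B 0 w t := by
  induction t with
  | zero => simp [state]
  | succ t ih =>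
    simp only [state, ih, mulVec_add, mulVec_zero, Pi.zero_apply, add_zero]
    abel

lemma markovG_mulVec_inputHist (L t : ℕ) :
    markovG A B C L *ᵥ inputHist u L t
      = ∑ i ∈ Finset.range L, (C * A ^ i * B) *ᵥ u (t - i) := by
  rw [← Fin.sum_univ_eq_sum_range fun i => (C * A ^ i * B) *ᵥ u (t - i)]
  ext j
  simp [markovG, inputHist, mulVec, dotProduct, Fintype.sum_prod_type]

lemma frobNorm_markovF_sq (L : ℕ) :
    frobNorm (markovF A C L) ^ 2 = ∑ i ∈ Finset.range L, frobNorm (C * A ^ i) ^ 2 := by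
  rw [← Fin.sum_univ_eq_sum_range fun i => frobNorm (C * A ^ i) ^ 2]
  simp only [frobNorm_sq]
  simp only [markovF, Fintype.sum_prod_type, of_apply]
  exact Finset.sum_comm

lemma design_mulVec_vec (L T : ℕ) (M : Matrix (Fin p) (Fin L × Fin p) ℝ) (τ : Fin (T - L)) :
    (design u L T *ᵥ Matrix.vec M) τ = u (L + 1 + τ) ⬝ᵥ (M *ᵥ inputHist u L (L + τ)) := by
  simp only [design, mulVec, dotProduct, Matrix.vec, of_apply]
  rw [Fintype.sum_prod_type, Finset.sum_comm]
  refine Finset.sum_congr rfl fun i _ => ?_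
  rw [Finset.mul_sum]
  exact Finset.sum_congr rfl fun j _ => by ring

/-- The residual of the true parameter splits into measurement noise, recent process noise,
old process noise and truncation bias. -/
lemma output_sub_eq (z : ℕ → ℝ) (L τ : ℕ) :
    output A B C u w z (L + 1 + τ) - u (L + 1 + τ) ⬝ᵥ (markovG A B C L *ᵥ inputHist u L (L + τ))
      = (z (L + 1 + τ)
        + ∑ i ∈ Finset.range L, u (L + 1 + τ) ⬝ᵥ ((C * A ^ i) *ᵥ w (L + τ - i))
        + u (L + 1 + τ) ⬝ᵥ ((C * A ^ L) *ᵥ state A B 0 w (τ + 1)))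
        + u (L + 1 + τ) ⬝ᵥ ((C * A ^ L) *ᵥ state A B u 0 (τ + 1)) := by
  have ht : L + 1 + τ = τ + 1 + L := by omega
  have hi : ∀ i, τ + 1 + L - 1 - i = L + τ - i := fun i => by omega
  rw [output, markovG_mulVec_inputHist]
  conv_lhs => rw [show state A B u w (L + 1 + τ) = state A B u w (τ + 1 + L) by rw [ht], state_add]
  rw [state_eq_add A B u w (τ + 1)]
  simp only [hi, mulVec_add, mulVec_sum, dotProduct_add, dotProduct_sum, mulVec_mulVec,
    Finset.sum_add_distrib, Matrix.mul_assoc]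
  ring

variable {A} {ρ : ℝ}

lemma abs_bias_le (h : specRadius A < ENNReal.ofReal ρ) (hρ1 : ρ < 1) {β : ℝ} (hβ : 0 ≤ β)
    (L s : ℕ) (v : Fin p → ℝ) (hv : euclNorm v ≤ β) (hu : ∀ t < s, euclNorm (u t) ≤ β) :
    |v ⬝ᵥ ((C * A ^ L) *ᵥ state A B u 0 s)|
      ≤ β ^ 2 * max (opNorm B) (opNorm C) ^ 2 * (transient A ρ * ρ ^ L / (1 - ρ)) := by
  have hρ := pos_of_specRadius_lt h
  have hφ := transient_nonneg (A := A) hρ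
  set K := max (opNorm B) (opNorm C) with hK
  have hB : opNorm B ≤ K := le_max_left _ _
  have hC : opNorm C ≤ K := le_max_right _ _
  have hB0 := opNorm_nonneg B
  have hC0 := opNorm_nonneg C
  have hK0 : 0 ≤ K := hB0.trans hB
  rw [state_eq_sum, mulVec_sum, dotProduct_sum]
  have hterm : ∀ i ∈ Finset.range s,
      |v ⬝ᵥ ((C * A ^ L) *ᵥ (A ^ i *ᵥ (B *ᵥ u (s - 1 - i) + (0 : ℕ → Fin n → ℝ) (s - 1 - i))))|
        ≤ β ^ 2 * K ^ 2 * (transient A ρ * ρ ^ L) * ρ ^ i := by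
    intro i hi
    have hus := hu (s - 1 - i) (by have := Finset.mem_range.1 hi; omega)
    rw [Pi.zero_apply, add_zero, mulVec_mulVec, mulVec_mulVec, Matrix.mul_assoc C, ← pow_add]
    have hop : opNorm (C * A ^ (L + i) * B) ≤ K * (transient A ρ * ρ ^ (L + i)) * K := by
      have h1 := opNorm_mul_le (C * A ^ (L + i)) B
      have h2 := opNorm_mul_le C (A ^ (L + i))
      have h3 := opNorm_pow_le h (L + i)
      have h4 := opNorm_nonneg (A ^ (L + i))
      calc _ ≤ opNorm (C * A ^ (L + i)) * opNorm B := h1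
        _ ≤ (opNorm C * opNorm (A ^ (L + i))) * opNorm B := by gcongr
        _ ≤ _ := by gcongr
    calc _ ≤ opNorm (C * A ^ (L + i) * B) * (euclNorm v * euclNorm (u (s - 1 - i))) :=
          abs_dotProduct_mulVec_le _ _ _
      _ ≤ K * (transient A ρ * ρ ^ (L + i)) * K * (β * β) := by
          have := euclNorm_nonneg v
          have := euclNorm_nonneg (u (s - 1 - i))
          have := opNorm_nonneg (C * A ^ (L + i) * B)
          gcongr
      _ = _ := by ring
  refine (Finset.abs_sum_le_sum_abs _ _).trans ((Finset.sum_le_sum hterm).trans ?_)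
  rw [← Finset.mul_sum]
  have hgeo : ∑ i ∈ Finset.range s, ρ ^ i ≤ 1 / (1 - ρ) := by
    rw [one_div, ← tsum_geometric_of_lt_one hρ.le hρ1]
    exact (summable_geometric_of_lt_one hρ.le hρ1).sum_le_tsum _ fun _ _ => by positivity
  calc _ ≤ β ^ 2 * K ^ 2 * (transient A ρ * ρ ^ L) * (1 / (1 - ρ)) :=
        mul_le_mul_of_nonneg_left hgeo (by positivity)
    _ = _ := by ring

end System

/-! ### Second moments of the noise terms -/

section Moments

variable {Ω : Type*} [MeasurableSpace Ω] {P : Measure Ω}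

/-- Additivity of variance under pairwise independence, with variances equal to second moments
because the means vanish. -/
lemma integral_sq_sum_of_indepFun [IsProbabilityMeasure P] {N : ℕ} {Y : ℕ → Ω → ℝ} (hY : ∀ s < N, MemLp (Y s) 2 P)
    (hind : ∀ s < N, ∀ t < N, s ≠ t → IndepFun (Y s) (Y t) P)
    (hmean : ∀ s < N, ∫ ω, Y s ω ∂P = 0) :
    ∫ ω, (∑ s ∈ Finset.range N, Y s ω) ^ 2 ∂P = ∑ s ∈ Finset.range N, ∫ ω, Y s ω ^ 2 ∂P := by
  have hY' : ∀ s ∈ Finset.range N, MemLp (Y s) 2 P := fun s hs => hY s (Finset.mem_range.1 hs)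
  have hvar := IndepFun.variance_sum hY' fun s hs t ht hst =>
    hind s (by simpa using hs) t (by simpa using ht) hst
  have h0 : ∫ ω, (∑ s ∈ Finset.range N, Y s) ω ∂P = 0 := by
    simp only [Finset.sum_apply]
    rw [integral_finsetSum _ fun s hs => (hY' s hs).integrable (by norm_num)]
    exact Finset.sum_eq_zero fun s hs => hmean s (Finset.mem_range.1 hs)
  rw [variance_of_integral_eq_zero (memLp_finsetSum' _ hY').aemeasurable h0] at hvar
  simp only [Finset.sum_apply] at hvar
  rw [hvar]
  exact Finset.sum_congr rfl fun s hs => variance_of_integral_eq_zero (hY' s hs).aemeasurable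
    (hmean s (Finset.mem_range.1 hs))

section ProcessNoise

variable {n T : ℕ} {w : ℕ → Ω → Fin n → ℝ} {S : Matrix (Fin n) (Fin n) ℝ}

lemma IsProcessNoise.memLp_dotProduct (hw : IsProcessNoise P T w S) {t : ℕ} (ht : t ≤ T)
    (g : Fin n → ℝ) : MemLp (fun ω => g ⬝ᵥ w t ω) 2 P :=
  memLp_finsetSum _ fun i _ => (hw.memLp t ht i).const_mul (g i)

lemma IsProcessNoise.integral_dotProduct [IsProbabilityMeasure P] (hw : IsProcessNoise P T w S) {t : ℕ} (ht : t ≤ T)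
    (g : Fin n → ℝ) : ∫ ω, g ⬝ᵥ w t ω ∂P = 0 := by
  simp only [dotProduct]
  rw [integral_finsetSum _ fun i _ => ((hw.memLp t ht i).integrable (by norm_num)).const_mul _]
  exact Finset.sum_eq_zero fun i _ => by rw [integral_const_mul, hw.mean t ht i, mul_zero]

lemma IsProcessNoise.integral_dotProduct_sq (hw : IsProcessNoise P T w S) {t : ℕ} (ht : t ≤ T)
    (g : Fin n → ℝ) : ∫ ω, (g ⬝ᵥ w t ω) ^ 2 ∂P = g ⬝ᵥ (S *ᵥ g) := by
  have hint : ∀ i j, Integrable (fun ω => w t ω i * w t ω j) P := fun i j =>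
    (hw.memLp t ht i).integrable_mul (hw.memLp t ht j)
  have he : ∀ ω, (g ⬝ᵥ w t ω) ^ 2 = ∑ i, ∑ j, g i * g j * (w t ω i * w t ω j) := by
    intro ω
    rw [sq, dotProduct, Finset.sum_mul_sum]
    exact Finset.sum_congr rfl fun i _ => Finset.sum_congr rfl fun j _ => by ring
  simp only [he]
  rw [integral_finsetSum _ fun i _ => integrable_finsetSum _ fun j _ => (hint i j).const_mul _]
  simp only [dotProduct, mulVec, Finset.mul_sum]
  refine Finset.sum_congr rfl fun i _ => ?_
  rw [integral_finsetSum _ fun j _ => (hint i j).const_mul _]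
  refine Finset.sum_congr rfl fun j _ => ?_
  rw [integral_const_mul, hw.cov t ht]
  ring

lemma IsProcessNoise.cov_nonneg (hw : IsProcessNoise P T w S) (v : Fin n → ℝ) :
    0 ≤ v ⬝ᵥ (S *ᵥ v) := by
  rw [← hw.integral_dotProduct_sq (Nat.zero_le T) v]
  exact integral_nonneg fun ω => sq_nonneg _

lemma IsProcessNoise.cov_transpose (hw : IsProcessNoise P T w S) : Sᵀ = S := by
  ext i j
  rw [transpose_apply, ← hw.cov 0 (Nat.zero_le T), ← hw.cov 0 (Nat.zero_le T)]
  simp only [mul_comm]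

lemma IsProcessNoise.integral_sum_dotProduct_sq [IsProbabilityMeasure P]
    (hw : IsProcessNoise P T w S) {N : ℕ}
    (hN : N ≤ T + 1) (g : ℕ → Fin n → ℝ) :
    ∫ ω, (∑ s ∈ Finset.range N, g s ⬝ᵥ w s ω) ^ 2 ∂P
      = ∑ s ∈ Finset.range N, g s ⬝ᵥ (S *ᵥ g s) := by
  rw [integral_sq_sum_of_indepFun (fun s hs => hw.memLp_dotProduct (by omega) (g s))
    (fun s hs t ht hst => ?_) fun s hs => hw.integral_dotProduct (by omega) (g s)]
  · exact Finset.sum_congr rfl fun s hs =>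
      hw.integral_dotProduct_sq (by have := Finset.mem_range.1 hs; omega) (g s)
  · have hmeas : ∀ v : Fin n → ℝ, Measurable fun x : Fin n → ℝ => v ⬝ᵥ x := fun v => by
      simp only [dotProduct]; fun_prop
    have := hw.indep.indepFun (i := ⟨s, by omega⟩) (j := ⟨t, by omega⟩) (by simpa using hst)
    exact this.comp (hmeas (g s)) (hmeas (g t))

lemma IsProcessNoise.memLp_sum_dotProduct (hw : IsProcessNoise P T w S) {N : ℕ}
    (hN : N ≤ T + 1) (g : ℕ → Fin n → ℝ) :
    MemLp (fun ω => ∑ s ∈ Finset.range N, g s ⬝ᵥ w s ω) 2 P :=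
  memLp_finsetSum _ fun s hs =>
    hw.memLp_dotProduct (by have := Finset.mem_range.1 hs; omega) (g s)

end ProcessNoise

section MeasurementNoise

variable {T : ℕ} {z : ℕ → Ω → ℝ} {σ : ℝ}

lemma IsMeasurementNoise.memLp_sum (hz : IsMeasurementNoise P T z σ) {N a : ℕ}
    (hN : a + N ≤ T + 1) (b : ℕ → ℝ) :
    MemLp (fun ω => ∑ τ ∈ Finset.range N, b τ * z (a + τ) ω) 2 P :=
  memLp_finsetSum _ fun τ hτ =>
    (hz.memLp _ (by have := Finset.mem_range.1 hτ; omega)).const_mul (b τ)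

lemma IsMeasurementNoise.integral_sum_sq [IsProbabilityMeasure P]
    (hz : IsMeasurementNoise P T z σ) {N a : ℕ}
    (hN : a + N ≤ T + 1) (b : ℕ → ℝ) :
    ∫ ω, (∑ τ ∈ Finset.range N, b τ * z (a + τ) ω) ^ 2 ∂P
      = σ ^ 2 * ∑ τ ∈ Finset.range N, b τ ^ 2 := by
  rw [integral_sq_sum_of_indepFun (fun s hs => (hz.memLp _ (by omega)).const_mul (b s))
    (fun s hs t ht hst => ?_) fun s hs => by
      rw [integral_const_mul, hz.mean _ (by omega), mul_zero]]
  · rw [Finset.mul_sum]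
    refine Finset.sum_congr rfl fun s hs => ?_
    simp only [mul_pow]
    rw [integral_const_mul, hz.var _ (by have := Finset.mem_range.1 hs; omega), mul_comm]
  · have := hz.indep.indepFun (i := ⟨a + s, by omega⟩) (j := ⟨a + t, by omega⟩)
      (by simpa using hst)
    exact this.comp (measurable_const_mul (b s)) (measurable_const_mul (b t))

end MeasurementNoise

end Moments

/-! ### The stochastic part of the residual -/

section Residual

variable {n p : ℕ} (A : Matrix (Fin n) (Fin n) ℝ) (B : Matrix (Fin n) (Fin p) ℝ)
  (C : Matrix (Fin p) (Fin n) ℝ) (u : ℕ → Fin p → ℝ)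

/-- The stochastic part of the residual of the true parameter at time `L + 1 + τ`. -/
def noiseResidual (w : ℕ → Fin n → ℝ) (z : ℕ → ℝ) (L τ : ℕ) : ℝ :=
  z (L + 1 + τ)
    + ∑ i ∈ Finset.range L, u (L + 1 + τ) ⬝ᵥ ((C * A ^ i) *ᵥ w (L + τ - i))
    + u (L + 1 + τ) ⬝ᵥ ((C * A ^ L) *ᵥ state A B 0 w (τ + 1))

/-- The weight of `w_s` in a combination of the recent-noise terms. -/
def windowWeight (L : ℕ) (b : ℕ → ℝ) (s : ℕ) : Fin n → ℝ :=
  ∑ i ∈ Finset.range L,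
    (if L ≤ s + i then b (s + i - L) else 0) • ((C * A ^ i)ᵀ *ᵥ u (s + i + 1))

lemma sum_window_eq {L T : ℕ} (hLT : L ≤ T) (b : ℕ → ℝ) (hb : ∀ m, T - L ≤ m → b m = 0)
    (w : ℕ → Fin n → ℝ) :
    ∑ τ ∈ Finset.range (T - L), b τ *
        ∑ i ∈ Finset.range L, u (L + 1 + τ) ⬝ᵥ ((C * A ^ i) *ᵥ w (L + τ - i))
      = ∑ s ∈ Finset.range T, windowWeight A C u L b s ⬝ᵥ w s := by
  -- Reindex the rows by `m = L + τ`, the time just before the output, so that row `m` meets `w s`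
  -- at `s = m - i`.
  set b' : ℕ → ℝ := fun m => if L ≤ m then b (m - L) else 0 with hb'
  have hb'0 : ∀ m, m < L ∨ T ≤ m → b' m = 0 := by
    rintro m (hm | hm)
    · simp [hb', not_le.2 hm]
    · simp only [hb']
      split_ifs
      · exact hb _ (by omega)
      · rfl
  have h1 : ∀ i ∈ Finset.range L,
      ∑ τ ∈ Finset.range (T - L), b τ * (u (L + 1 + τ) ⬝ᵥ ((C * A ^ i) *ᵥ w (L + τ - i)))
        = ∑ s ∈ Finset.range T, b' (s + i) * (u (s + i + 1) ⬝ᵥ ((C * A ^ i) *ᵥ w s)) := by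
    intro i hi
    rw [← sum_range_sub_eq_sum_range_add (Finset.mem_range.1 hi).le hLT
      (fun m s => b' m * (u (m + 1) ⬝ᵥ ((C * A ^ i) *ᵥ w s)))
      fun m s hm => by rw [hb'0 m hm, zero_mul]]
    obtain ⟨N, rfl⟩ := Nat.exists_eq_add_of_le hLT
    rw [Finset.sum_range_add, Finset.sum_eq_zero (s := Finset.range L) fun m hm => by
      rw [hb'0 m (Or.inl (Finset.mem_range.1 hm)), zero_mul], zero_add, Nat.add_sub_cancel_left]
    refine Finset.sum_congr rfl fun τ _ => ?_
    simp [hb', add_right_comm L 1 τ]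
  simp only [Finset.mul_sum]
  rw [Finset.sum_comm, Finset.sum_congr rfl h1, Finset.sum_comm]
  refine Finset.sum_congr rfl fun s _ => ?_
  rw [windowWeight, sum_dotProduct]
  refine Finset.sum_congr rfl fun i _ => ?_
  rw [smul_dotProduct, smul_eq_mul, mulVec_transpose, ← dotProduct_mulVec]

/-- Summation by parts pairing the forward state with the backward adjoint. The increments of `g j
⬝ᵥ (A *ᵥ x j)` telescope, and both boundary terms vanish since `x 0 = 0` and `g N = 0`. -/
lemma sum_tail_eq (L N : ℕ) (b : ℕ → ℝ) (hb : ∀ m, N ≤ m → b m = 0) (w : ℕ → Fin n → ℝ) :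
    ∑ τ ∈ Finset.range N, b τ * (u (L + 1 + τ) ⬝ᵥ ((C * A ^ L) *ᵥ state A B 0 w (τ + 1)))
      = ∑ j ∈ Finset.range N,
        adjointState A N b (fun τ => (C * A ^ L)ᵀ *ᵥ u (L + 1 + τ)) j ⬝ᵥ w j := by
  set d : ℕ → Fin n → ℝ := fun τ => (C * A ^ L)ᵀ *ᵥ u (L + 1 + τ) with hd
  set g := adjointState A N b d with hg
  set x := state A B 0 w with hx
  have hstep : ∀ j, b j * (u (L + 1 + j) ⬝ᵥ ((C * A ^ L) *ᵥ x (j + 1)))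
      = g j ⬝ᵥ w j - (g (j + 1) ⬝ᵥ (A *ᵥ x (j + 1)) - g j ⬝ᵥ (A *ᵥ x j)) := by
    intro j
    have e1 : u (L + 1 + j) ⬝ᵥ ((C * A ^ L) *ᵥ x (j + 1)) = d j ⬝ᵥ x (j + 1) := by
      rw [dotProduct_mulVec, ← mulVec_transpose]
    have e2 : g (j + 1) ⬝ᵥ (A *ᵥ x (j + 1)) = (Aᵀ *ᵥ g (j + 1)) ⬝ᵥ x (j + 1) := by
      rw [dotProduct_mulVec, ← mulVec_transpose]
    have e3 : g j ⬝ᵥ x (j + 1) = b j * (d j ⬝ᵥ x (j + 1)) + (Aᵀ *ᵥ g (j + 1)) ⬝ᵥ x (j + 1) := by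
      conv_lhs => rw [hg, adjointState_eq hb j, add_dotProduct, smul_dotProduct, smul_eq_mul]
    have e4 : g j ⬝ᵥ x (j + 1) = g j ⬝ᵥ (A *ᵥ x j) + g j ⬝ᵥ w j := by
      rw [hx, state]; simp [dotProduct_add]
    rw [e1, e2]
    linarith
  rw [Finset.sum_congr rfl fun j _ => hstep j, Finset.sum_sub_distrib,
    Finset.sum_range_sub fun j => g j ⬝ᵥ (A *ᵥ x j)]
  simp [hx, state, hg, adjointState_eq_of_le hb le_rfl]

lemma sum_noiseResidual_eq {L T : ℕ} (hLT : L ≤ T) (b : ℕ → ℝ) (hb : ∀ m, T - L ≤ m → b m = 0)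
    (w : ℕ → Fin n → ℝ) (z : ℕ → ℝ) :
    ∑ τ ∈ Finset.range (T - L), b τ * noiseResidual A B C u w z L τ
      = ∑ τ ∈ Finset.range (T - L), b τ * z (L + 1 + τ)
        + ∑ s ∈ Finset.range T, windowWeight A C u L b s ⬝ᵥ w s
        + ∑ j ∈ Finset.range (T - L),
          adjointState A (T - L) b (fun τ => (C * A ^ L)ᵀ *ᵥ u (L + 1 + τ)) j ⬝ᵥ w j := by
  rw [← sum_window_eq A C u hLT b hb w, ← sum_tail_eq A B C u L (T - L) b hb w,
    ← Finset.sum_add_distrib, ← Finset.sum_add_distrib]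
  exact Finset.sum_congr rfl fun τ _ => by rw [noiseResidual]; ring

variable {A C u}

lemma sum_windowWeight_quadratic_le {L T : ℕ} (hLT : L ≤ T) {β : ℝ}
    (hu : ∀ t ≤ T, euclNorm (u t) ≤ β) (S : Matrix (Fin n) (Fin n) ℝ) (b : ℕ → ℝ)
    (hb : ∀ m, T - L ≤ m → b m = 0) :
    ∑ s ∈ Finset.range T, windowWeight A C u L b s ⬝ᵥ (S *ᵥ windowWeight A C u L b s)
      ≤ opNorm S * frobNorm (markovF A C L) ^ 2 * β ^ 2 * L
        * ∑ τ ∈ Finset.range (T - L), b τ ^ 2 := by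
  have h1 : ∀ s ∈ Finset.range T,
      windowWeight A C u L b s ⬝ᵥ (S *ᵥ windowWeight A C u L b s)
        ≤ opNorm S * euclNorm (windowWeight A C u L b s) ^ 2 := fun s _ => by
    rw [sq]
    exact (le_abs_self _).trans (abs_dotProduct_mulVec_le _ _ _)
  have h2 := sum_sq_euclNorm_window_le hLT (fun m => if L ≤ m then b (m - L) else 0)
    (by
      rintro m (hm | hm)
      · simp [not_le.2 hm]
      · simp only [ite_eq_right_iff]
        exact fun _ => hb _ (by omega))
    (fun m i => (C * A ^ i)ᵀ *ᵥ u (m + 1)) (fun i => frobNorm (C * A ^ i) * β)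
    (fun m i hm _ => by
      rw [← frobNorm_transpose]
      exact (euclNorm_mulVec_le_frobNorm _ _).trans
        (mul_le_mul_of_nonneg_left (hu _ hm) (frobNorm_nonneg _)))
  have h3 : ∑ m ∈ Finset.range T, (if L ≤ m then b (m - L) else 0) ^ 2
      = ∑ τ ∈ Finset.range (T - L), b τ ^ 2 := by
    obtain ⟨N, rfl⟩ := Nat.exists_eq_add_of_le hLT
    rw [Finset.sum_range_add, Finset.sum_eq_zero (s := Finset.range L) fun m hm => by
      simp [not_le.2 (Finset.mem_range.1 hm)], zero_add, Nat.add_sub_cancel_left]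
    simp
  rw [h3] at h2
  refine (Finset.sum_le_sum h1).trans ?_
  rw [← Finset.mul_sum]
  refine (mul_le_mul_of_nonneg_left h2 (opNorm_nonneg S)).trans (le_of_eq ?_)
  simp only [mul_pow]
  rw [← Finset.sum_mul, ← frobNorm_markovF_sq]
  ring

variable {Ω : Type*} [MeasurableSpace Ω] {P : Measure Ω} {L T : ℕ} {w : ℕ → Ω → Fin n → ℝ} {z : ℕ → Ω → ℝ} {S : Matrix (Fin n) (Fin n) ℝ} {σz ρ β : ℝ}

lemma memLp_sum_noiseResidual (hLT : L ≤ T) (hw : IsProcessNoise P T w S)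
    (hz : IsMeasurementNoise P T z σz) (b : ℕ → ℝ) (hb : ∀ m, T - L ≤ m → b m = 0) :
    MemLp (fun ω => ∑ τ ∈ Finset.range (T - L),
      b τ * noiseResidual A B C u (fun t => w t ω) (fun t => z t ω) L τ) 2 P := by
  simp only [sum_noiseResidual_eq A B C u hLT b hb]
  exact ((hz.memLp_sum (by omega) b).add (hw.memLp_sum_dotProduct (by omega) _)).add
    (hw.memLp_sum_dotProduct (by omega) _)

lemma integral_sum_noiseResidual_sq_le [IsProbabilityMeasure P]
    (h : specRadius A < ENNReal.ofReal ρ) (hρ1 : ρ < 1)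
    (hLT : L ≤ T) (hβ : 0 ≤ β) (hu : ∀ t ≤ T, euclNorm (u t) ≤ β)
    (hw : IsProcessNoise P T w S) (hz : IsMeasurementNoise P T z σz)
    (b : ℕ → ℝ) (hb : ∀ m, T - L ≤ m → b m = 0) :
    ∫ ω, (∑ τ ∈ Finset.range (T - L),
      b τ * noiseResidual A B C u (fun t => w t ω) (fun t => z t ω) L τ) ^ 2 ∂P
      ≤ 6 * (σz ^ 2 + sigmaWSq A C S ρ L * β ^ 2 * L + sigmaESq A C S ρ L * β ^ 2)
        * ∑ τ ∈ Finset.range (T - L), b τ ^ 2 := by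
  have hρ := pos_of_specRadius_lt h
  have hφ := transient_nonneg (A := A) hρ
  have h1ρ : 0 < 1 - ρ := sub_pos.2 hρ1
  set E := ∑ τ ∈ Finset.range (T - L), b τ ^ 2 with hE
  have hE0 : 0 ≤ E := Finset.sum_nonneg fun _ _ => sq_nonneg _
  have mZ := hz.memLp_sum (N := T - L) (a := L + 1) (by omega) b
  have mW := hw.memLp_sum_dotProduct (N := T) (by omega) (windowWeight A C u L b)
  have mE := hw.memLp_sum_dotProduct (N := T - L) (by omega)
    (adjointState A (T - L) b (fun τ => (C * A ^ L)ᵀ *ᵥ u (L + 1 + τ)))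
  have bZ : _ = σz ^ 2 * E := hz.integral_sum_sq (N := T - L) (a := L + 1) (by omega) b
  have bW := (hw.integral_sum_dotProduct_sq (N := T) (by omega) (windowWeight A C u L b)).trans_le
    (sum_windowWeight_quadratic_le hLT hu S b hb)
  have bE := (hw.integral_sum_dotProduct_sq (N := T - L) (by omega)
    (adjointState A (T - L) b (fun τ => (C * A ^ L)ᵀ *ᵥ u (L + 1 + τ)))).trans_le
    (sum_adjointState_quadratic_le h hρ1 hw.cov_transpose hw.cov_nonneg
      (D := opNorm (C * A ^ L) * β) (mul_nonneg (opNorm_nonneg _) hβ) hb fun m hm => by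
        rw [← opNorm_transpose (C * A ^ L)]
        exact (euclNorm_mulVec_le _ _).trans
          (mul_le_mul_of_nonneg_left (hu _ (by omega)) (opNorm_nonneg _)))
  rw [← hE] at bW bE
  have hWle : opNorm S * frobNorm (markovF A C L) ^ 2 ≤ sigmaWSq A C S ρ L := by
    unfold sigmaWSq
    have := opNorm_nonneg S
    refine le_mul_of_one_le_right (by positivity) (le_add_of_nonneg_right (by positivity))
  have bW' : opNorm S * frobNorm (markovF A C L) ^ 2 * β ^ 2 * L * E
      ≤ sigmaWSq A C S ρ L * β ^ 2 * L * E := by gcongr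
  have bE' : 2 * (opNorm (gramian A S) * (opNorm (C * A ^ L) * β) ^ 2 * (transient A ρ / (1 - ρ)))
      * E = 2 * (sigmaESq A C S ρ L * β ^ 2 * E) := by unfold sigmaESq; ring
  rw [bE'] at bE
  simp only [sum_noiseResidual_eq A B C u hLT b hb]
  have iZ := mZ.integrable_sq
  have iW := mW.integrable_sq
  have iE := mE.integrable_sq
  have hσz : 0 ≤ σz ^ 2 * E := by positivity
  have hσw : 0 ≤ sigmaWSq A C S ρ L * β ^ 2 * L * E := by
    have := opNorm_nonneg S
    have := (by positivity : 0 ≤ opNorm S * frobNorm (markovF A C L) ^ 2).trans hWle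
    positivity
  refine (integral_mono_of_nonneg (.of_forall fun ω => sq_nonneg _)
    (((iZ.const_mul 3).add (iW.const_mul 3)).add (iE.const_mul 3))
    (.of_forall fun ω => ?_)).trans ?_
  · simp only [Pi.add_apply]
    generalize (∑ τ ∈ Finset.range (T - L), b τ * z (L + 1 + τ) ω) = x1
    generalize (∑ s ∈ Finset.range T, windowWeight A C u L b s ⬝ᵥ w s ω) = x2
    generalize (∑ j ∈ Finset.range (T - L),
      adjointState A (T - L) b (fun τ => (C * A ^ L)ᵀ *ᵥ u (L + 1 + τ)) j ⬝ᵥ w j ω) = x3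
    -- The inequality `(x1 + x2 + x3) ^ 2 ≤ 3 * (x1 ^ 2 + x2 ^ 2 + x3 ^ 2)` replaces any
    -- independence between the three parts, two of which involve the same `w`. With the factor 2 of
    -- the tail bound it gives the constant 6.
    nlinarith [sq_nonneg (x1 - x2), sq_nonneg (x1 - x3), sq_nonneg (x2 - x3)]
  · rw [integral_add' ((iZ.const_mul 3).add (iW.const_mul 3)) (iE.const_mul 3),
      integral_add' (iZ.const_mul 3) (iW.const_mul 3), integral_const_mul, integral_const_mul,
      integral_const_mul, bZ]
    linarith

end Residual

/-! ### Projections and least squares -/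

section Projection

variable {E : Type*} [NormedAddCommGroup E] [InnerProductSpace ℝ E] (K : Submodule ℝ E)
  [FiniteDimensional ℝ K]

lemma eq_starProjection_of_forall_norm_le {x r : E} (hx : x ∈ K)
    (hmin : ∀ y ∈ K, ‖r - x‖ ≤ ‖r - y‖) : x = K.starProjection r := by
  have hinf : ‖r - x‖ = ⨅ y : K, ‖r - y‖ :=
    le_antisymm (le_ciInf fun y => hmin y y.2)
      (ciInf_le ⟨0, Set.forall_mem_range.2 fun _ => norm_nonneg _⟩ (⟨x, hx⟩ : K))
  exact (Submodule.eq_starProjection_of_mem_of_inner_eq_zero hx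
    ((K.norm_eq_iInf_iff_real_inner_eq_zero hx).1 hinf)).symm

/-- Parseval in the subspace; a basis vector of `K` has the same inner product with `s` as with its
projection. This reduces the projected noise to scalar second moments. -/
lemma norm_starProjection_sq (s : E) :
    ‖K.starProjection s‖ ^ 2 = ∑ i, inner ℝ (stdOrthonormalBasis ℝ K i : E) s ^ 2 := by
  rw [Submodule.starProjection_apply, ← Submodule.coe_norm,
    ← (stdOrthonormalBasis ℝ K).sum_sq_inner_right]
  simp only [Submodule.inner_orthogonalProjectionOnto_eq_of_mem_left]

end Projection

section LeastSquares

variable {p : ℕ} (u : ℕ → Fin p → ℝ) (L T : ℕ)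

/-- The range of the design matrix. -/
def designRange : Submodule ℝ (EuclideanSpace ℝ (Fin (T - L))) :=
  LinearMap.range ((WithLp.linearEquiv 2 ℝ (Fin (T - L) → ℝ)).symm.toLinearMap ∘ₗ
    (design u L T).mulVecLin)

lemma toLp_design_mulVec_mem (v : (Fin L × Fin p) × Fin p → ℝ) :
    WithLp.toLp 2 (design u L T *ᵥ v) ∈ designRange u L T :=
  ⟨v, rfl⟩

lemma finrank_designRange_le : Module.finrank ℝ (designRange u L T) ≤ p ^ 2 * L := by
  refine (LinearMap.finrank_range_le _).trans (le_of_eq ?_)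
  simp
  ring

lemma ellNorm_designGram (v : (Fin L × Fin p) × Fin p → ℝ) :
    ellNorm (designGram u L T) v = euclNorm (design u L T *ᵥ v) := by
  rw [ellNorm, designGram, ← mulVec_mulVec, dotProduct_mulVec, vecMul_transpose,
    dotProduct_self_eq_euclNorm_sq, Real.sqrt_sq (euclNorm_nonneg _)]

variable {u L T}

lemma lsObjective_eq (y : ℕ → ℝ) (G G' : Matrix (Fin p) (Fin L × Fin p) ℝ) :
    lsObjective u y L T G' = 1 / (2 * ((T : ℝ) - L)) *
      euclNorm ((fun τ : Fin (T - L) =>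
          y (L + 1 + τ) - u (L + 1 + τ) ⬝ᵥ (G *ᵥ inputHist u L (L + τ)))
        - design u L T *ᵥ (Matrix.vec G' - Matrix.vec G)) ^ 2 := by
  have hIcc : Finset.Icc (L + 1) T = Finset.Ico (L + 1) (T + 1) := by ext; simp
  rw [lsObjective, hIcc, Finset.sum_Ico_eq_sum_range, Nat.add_sub_add_right,
    ← Fin.sum_univ_eq_sum_range fun τ => (y (L + 1 + τ)
      - u (L + 1 + τ) ⬝ᵥ (G' *ᵥ inputHist u L (L + 1 + τ - 1))) ^ 2, euclNorm_sq]
  congr 1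
  refine Finset.sum_congr rfl fun τ _ => ?_
  have ht : L + 1 + (τ : ℕ) - 1 = L + τ := by omega
  rw [ht, mulVec_sub, Pi.sub_apply, Pi.sub_apply, design_mulVec_vec, design_mulVec_vec]
  ring

lemma IsLeastSquares.toLp_design_eq {y : ℕ → ℝ} {G Ghat : Matrix (Fin p) (Fin L × Fin p) ℝ}
    (hLT : L < T) (h : IsLeastSquares u y L T Ghat) :
    WithLp.toLp 2 (design u L T *ᵥ (Matrix.vec Ghat - Matrix.vec G))
      = (designRange u L T).starProjection (WithLp.toLp 2 fun τ : Fin (T - L) =>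
          y (L + 1 + τ) - u (L + 1 + τ) ⬝ᵥ (G *ᵥ inputHist u L (L + τ))) := by
  refine eq_starProjection_of_forall_norm_le _ (toLp_design_mulVec_mem u L T _) ?_
  rintro _ ⟨v, rfl⟩
  -- Every point of the range comes from a competitor matrix, so minimality of the objective is
  -- minimality of distance over the whole subspace.
  obtain ⟨M, hM⟩ := Matrix.vec_bijective.surjective (v + Matrix.vec G)
  have hle := h M
  have hpos : 0 < 1 / (2 * ((T : ℝ) - L)) := by
    have : (L : ℝ) < T := by exact_mod_cast hLT
    exact one_div_pos.2 (by linarith)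
  rw [lsObjective_eq y G Ghat, lsObjective_eq y G M, hM, add_sub_cancel_right,
    mul_le_mul_iff_right₀ hpos, sq_le_sq₀ (euclNorm_nonneg _) (euclNorm_nonneg _)] at hle
  exact hle

end LeastSquares

/-! ### The error bound -/

section Main

variable {Ω : Type*} [MeasurableSpace Ω] {P : Measure Ω} [IsProbabilityMeasure P]

lemma ofReal_one_sub_le_measure_of_integral_le {Q : Ω → ℝ} (hQ : ∀ ω, 0 ≤ Q ω)
    (hint : Integrable Q P) {δ R : ℝ} (hδ : 0 ≤ δ) (hR : 0 ≤ R) (h : ∫ ω, Q ω ∂P ≤ δ * R) :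
    ENNReal.ofReal (1 - δ) ≤ P {ω | Q ω ≤ R} := by
  have hmeas : NullMeasurableSet {ω | Q ω ≤ R} P :=
    nullMeasurableSet_le hint.aestronglyMeasurable.aemeasurable aemeasurable_const
  have hbad : P {ω | Q ω ≤ R}ᶜ ≤ ENNReal.ofReal δ := by
    -- Markov's inequality needs a positive threshold; when `R = 0`, the nonnegative `Q` has zero
    -- integral and vanishes almost surely.
    rcases hR.eq_or_lt with rfl | hR
    · have h0 : Q =ᵐ[P] 0 := (integral_eq_zero_iff_of_nonneg hQ hint).1
        (le_antisymm (by simpa using h) (integral_nonneg hQ))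
      have : P {ω | Q ω ≤ 0}ᶜ = 0 := by
        filter_upwards [h0] with ω hω
        simp [hω]
      simp [this]
    · have hM := mul_meas_ge_le_integral_of_nonneg (.of_forall hQ) hint R
      have h1 : P.real {ω | R ≤ Q ω} ≤ δ := by
        rw [← mul_le_mul_iff_right₀ hR]
        linarith [mul_comm δ R]
      calc P {ω | Q ω ≤ R}ᶜ ≤ P {ω | R ≤ Q ω} := measure_mono fun ω hω => by
            simp only [Set.mem_compl_iff, Set.mem_ofPred_eq, not_le] at hω
            exact hω.le
        _ ≤ ENNReal.ofReal δ := by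
            rw [← ofReal_measureReal]
            exact ENNReal.ofReal_le_ofReal h1
  rw [prob_compl_eq_one_sub₀ hmeas] at hbad
  rw [ENNReal.ofReal_sub _ hδ, ENNReal.ofReal_one]
  exact tsub_le_iff_tsub_le.1 hbad

variable {n p L T : ℕ} {A : Matrix (Fin n) (Fin n) ℝ} (B : Matrix (Fin n) (Fin p) ℝ)
  {C : Matrix (Fin p) (Fin n) ℝ} {u : ℕ → Fin p → ℝ} {w : ℕ → Ω → Fin n → ℝ} {z : ℕ → Ω → ℝ}
  {S : Matrix (Fin n) (Fin n) ℝ} {σz ρ β : ℝ}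

lemma inner_toLp_eq_sum_range {N : ℕ} (a : EuclideanSpace ℝ (Fin N)) (f : ℕ → ℝ) :
    inner ℝ a (WithLp.toLp 2 fun τ : Fin N => f τ)
      = ∑ τ ∈ Finset.range N, (if h : τ < N then a ⟨τ, h⟩ else 0) * f τ := by
  rw [← Fin.sum_univ_eq_sum_range fun τ => (if h : τ < N then a ⟨τ, h⟩ else 0) * f τ]
  simp [PiLp.inner_apply, mul_comm]

lemma integral_inner_noiseResidual_sq_le (h : specRadius A < ENNReal.ofReal ρ) (hρ1 : ρ < 1)
    (hLT : L ≤ T) (hβ : 0 ≤ β) (hu : ∀ t ≤ T, euclNorm (u t) ≤ β)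
    (hw : IsProcessNoise P T w S) (hz : IsMeasurementNoise P T z σz)
    (a : EuclideanSpace ℝ (Fin (T - L))) :
    Integrable (fun ω => inner ℝ a (WithLp.toLp 2 fun τ : Fin (T - L) =>
        noiseResidual A B C u (fun t => w t ω) (fun t => z t ω) L τ) ^ 2) P ∧
      ∫ ω, inner ℝ a (WithLp.toLp 2 fun τ : Fin (T - L) =>
        noiseResidual A B C u (fun t => w t ω) (fun t => z t ω) L τ) ^ 2 ∂P
      ≤ 6 * (σz ^ 2 + sigmaWSq A C S ρ L * β ^ 2 * L + sigmaESq A C S ρ L * β ^ 2) * ‖a‖ ^ 2 := by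
  -- Extension by zero supplies the vanishing beyond `T - L` on which the reindexing and the adjoint
  -- recursion rely.
  set b : ℕ → ℝ := fun τ => if h : τ < T - L then a ⟨τ, h⟩ else 0 with hb
  have hb0 : ∀ m, T - L ≤ m → b m = 0 := fun m hm => by simp [hb, not_lt.2 hm]
  have hnorm : ‖a‖ ^ 2 = ∑ τ ∈ Finset.range (T - L), b τ ^ 2 := by
    rw [← Fin.sum_univ_eq_sum_range fun τ => b τ ^ 2, EuclideanSpace.norm_sq_eq]
    simp [hb]
  have he : ∀ ω, inner ℝ a (WithLp.toLp 2 fun τ : Fin (T - L) =>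
        noiseResidual A B C u (fun t => w t ω) (fun t => z t ω) L τ)
      = ∑ τ ∈ Finset.range (T - L),
        b τ * noiseResidual A B C u (fun t => w t ω) (fun t => z t ω) L τ := fun ω =>
    inner_toLp_eq_sum_range a fun τ => noiseResidual A B C u (fun t => w t ω) (fun t => z t ω) L τ
  simp only [he]
  rw [hnorm]
  exact ⟨(memLp_sum_noiseResidual B hLT hw hz b hb0).integrable_sq,
    integral_sum_noiseResidual_sq_le B h hρ1 hLT hβ hu hw hz b hb0⟩

lemma variance_proxy_nonneg (hρ : 0 < ρ) (hρ1 : ρ < 1) :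
    0 ≤ σz ^ 2 + sigmaWSq A C S ρ L * β ^ 2 * L + sigmaESq A C S ρ L * β ^ 2 := by
  have h1 := transient_nonneg (A := A) hρ
  have h2 := opNorm_nonneg S
  have h3 := opNorm_nonneg (gramian A S)
  have h4 : 0 < 1 - ρ := sub_pos.2 hρ1
  unfold sigmaWSq sigmaESq
  positivity

lemma ofReal_one_sub_le_measure_norm_projection (h : specRadius A < ENNReal.ofReal ρ)
    (hρ1 : ρ < 1) (hLT : L ≤ T) (hβ : 0 ≤ β) (hu : ∀ t ≤ T, euclNorm (u t) ≤ β)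
    (hw : IsProcessNoise P T w S) (hz : IsMeasurementNoise P T z σz) {δ : ℝ} (hδ : 0 < δ) :
    ENNReal.ofReal (1 - δ) ≤ P {ω | ‖(designRange u L T).starProjection
        (WithLp.toLp 2 fun τ : Fin (T - L) =>
          noiseResidual A B C u (fun t => w t ω) (fun t => z t ω) L τ)‖ ^ 2
      ≤ 6 * ((p : ℝ) ^ 2 * L / δ *
        (σz ^ 2 + sigmaWSq A C S ρ L * β ^ 2 * L + sigmaESq A C S ρ L * β ^ 2))} := by
  have hX := variance_proxy_nonneg (A := A) (C := C) (S := S) (σz := σz) (β := β) (L := L)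
    (pos_of_specRadius_lt h) hρ1
  set X := σz ^ 2 + sigmaWSq A C S ρ L * β ^ 2 * L + sigmaESq A C S ρ L * β ^ 2
  have hmom := integral_inner_noiseResidual_sq_le (A := A) (C := C) B h hρ1 hLT hβ hu hw hz
  refine ofReal_one_sub_le_measure_of_integral_le (fun ω => sq_nonneg _) ?_ hδ.le
    (by positivity) ?_
  · simp only [norm_starProjection_sq]
    exact integrable_finsetSum _ fun i _ => (hmom _).1
  · simp only [norm_starProjection_sq]
    rw [integral_finsetSum _ fun i _ => (hmom _).1]
    have hone : ∀ i, ‖(stdOrthonormalBasis ℝ (designRange u L T) i :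
        EuclideanSpace ℝ (Fin (T - L)))‖ = 1 := fun i =>
      (stdOrthonormalBasis ℝ (designRange u L T)).orthonormal.1 i
    have hrank : (Module.finrank ℝ (designRange u L T) : ℝ) ≤ (p : ℝ) ^ 2 * L := by
      exact_mod_cast finrank_designRange_le u L T
    calc _ ≤ ∑ _i : Fin (Module.finrank ℝ (designRange u L T)), 6 * X :=
          Finset.sum_le_sum fun i _ =>
            (hmom _).2.trans_eq (by rw [hone i, one_pow, mul_one])
      _ = Module.finrank ℝ (designRange u L T) * (6 * X) := by simp
      _ ≤ (p : ℝ) ^ 2 * L * (6 * X) := by gcongr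
      _ = δ * (6 * ((p : ℝ) ^ 2 * L / δ * X)) := by field_simp

variable {B}

lemma ellNorm_vec_sub_le (h : specRadius A < ENNReal.ofReal ρ) (hρ1 : ρ < 1) (hLT : L < T)
    (hβ : 0 ≤ β) (hu : ∀ t ≤ T, euclNorm (u t) ≤ β) {x : ℕ → Fin n → ℝ} {ζ : ℕ → ℝ}
    {Ghat : Matrix (Fin p) (Fin L × Fin p) ℝ}
    (hG : IsLeastSquares u (output A B C u x ζ) L T Ghat) {δ : ℝ}
    (hs : ‖(designRange u L T).starProjection
        (WithLp.toLp 2 fun τ : Fin (T - L) => noiseResidual A B C u x ζ L τ)‖ ^ 2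
      ≤ 6 * ((p : ℝ) ^ 2 * L / δ *
        (σz ^ 2 + sigmaWSq A C S ρ L * β ^ 2 * L + sigmaESq A C S ρ L * β ^ 2))) :
    ellNorm (designGram u L T) (Matrix.vec Ghat - Matrix.vec (markovG A B C L))
      ≤ 3 * errorBound A B C S σz β ρ δ L T := by
  set Y := (p : ℝ) ^ 2 * L / δ *
    (σz ^ 2 + sigmaWSq A C S ρ L * β ^ 2 * L + sigmaESq A C S ρ L * β ^ 2) with hY
  set D := β ^ 2 * max (opNorm B) (opNorm C) ^ 2 * (transient A ρ * ρ ^ L / (1 - ρ)) with hD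
  have hD0 : 0 ≤ D := by
    have h1 := pos_of_specRadius_lt h
    have h2 := transient_nonneg (A := A) h1
    have h3 : 0 < 1 - ρ := sub_pos.2 hρ1
    positivity
  set bias : Fin (T - L) → ℝ := fun τ =>
    u (L + 1 + τ) ⬝ᵥ ((C * A ^ L) *ᵥ state A B u 0 (τ + 1)) with hbias
  have hdecomp : (WithLp.toLp 2 fun τ : Fin (T - L) => output A B C u x ζ (L + 1 + τ)
        - u (L + 1 + τ) ⬝ᵥ (markovG A B C L *ᵥ inputHist u L (L + τ)))
      = WithLp.toLp 2 (fun τ : Fin (T - L) => noiseResidual A B C u x ζ L τ)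
        + (WithLp.toLp 2 bias : EuclideanSpace ℝ (Fin (T - L))) := by
    ext τ
    simpa [noiseResidual, hbias] using output_sub_eq A B C u x ζ L τ
  have hb : ‖(WithLp.toLp 2 bias : EuclideanSpace ℝ (Fin (T - L)))‖ ≤ D * √((T : ℝ) - L) := by
    have hTL : 0 ≤ (T : ℝ) - L := sub_nonneg.2 (by exact_mod_cast hLT.le)
    refine le_of_sq_le_sq ?_ (by positivity)
    rw [EuclideanSpace.norm_sq_eq, mul_pow, Real.sq_sqrt hTL]
    calc ∑ τ, ‖bias τ‖ ^ 2 ≤ ∑ _τ : Fin (T - L), D ^ 2 := by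
          refine Finset.sum_le_sum fun τ _ => pow_le_pow_left₀ (norm_nonneg _) ?_ 2
          exact abs_bias_le B C u h hρ1 hβ L _ _ (hu _ (by omega)) fun t ht => hu t (by omega)
      _ = D ^ 2 * ((T : ℝ) - L) := by
          simp [Nat.cast_sub hLT.le]; ring
  have hs' : ‖(designRange u L T).starProjection
      (WithLp.toLp 2 fun τ : Fin (T - L) => noiseResidual A B C u x ζ L τ)‖ ≤ 3 * √Y := by
    have hY0 : 0 ≤ Y := by linarith [hs.trans' (sq_nonneg _)]
    refine le_of_sq_le_sq ?_ (by positivity)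
    rw [mul_pow, Real.sq_sqrt hY0]
    -- The final constant 3 arises here, from `6 ≤ 3 ^ 2`.
    linarith
  have hbproj := (designRange u L T).norm_starProjection_apply_le
    (WithLp.toLp 2 bias : EuclideanSpace ℝ (Fin (T - L)))
  rw [ellNorm_designGram, euclNorm, hG.toLp_design_eq hLT, hdecomp, map_add, errorBound, ← hY, ← hD]
  refine (norm_add_le _ _).trans ?_
  have : 0 ≤ D * √((T : ℝ) - L) := by positivity
  linarith

lemma frobNorm_sub_le_of_ellNorm_le {V : Matrix ((Fin L × Fin p) × Fin p) ((Fin L × Fin p) × Fin p) ℝ}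
    (hV : V.PosDef) {M N : Matrix (Fin p) (Fin L × Fin p) ℝ} {a : ℝ}
    (h : ellNorm V (Matrix.vec M - Matrix.vec N) ≤ a) :
    frobNorm (M - N) ≤ a / √(lambdaMin V) := by
  rw [← euclNorm_vec, Matrix.vec_sub]
  rcases isEmpty_or_nonempty ((Fin L × Fin p) × Fin p) with hE | hE
  -- With an empty index type, positivity of `lambdaMin V` is not available, but the error itself is
  -- zero.
  · have h0 : euclNorm (Matrix.vec M - Matrix.vec N) = 0 := by
      rw [Subsingleton.elim (Matrix.vec M - Matrix.vec N) 0, euclNorm_zero]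
    rw [h0]
    exact div_nonneg ((Real.sqrt_nonneg _).trans h) (Real.sqrt_nonneg _)
  · have hpos := lambdaMin_pos hV
    rw [le_div_iff₀ (Real.sqrt_pos.2 hpos)]
    refine le_trans (Real.le_sqrt_of_sq_le ?_) h
    rw [mul_pow, Real.sq_sqrt hpos.le, mul_comm]
    exact lambdaMin_mul_sq_le hV.isHermitian _

end Main

end BilinearObs

theorem mainTheorem1 :
    ∃ c : ℝ, 0 < c ∧
      ∀ (n p L T : ℕ), 1 ≤ L → L < T →
      ∀ (A : Matrix (Fin n) (Fin n) ℝ) (B : Matrix (Fin n) (Fin p) ℝ)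
        (C : Matrix (Fin p) (Fin n) ℝ) (ρ : ℝ),
        BilinearObs.specRadius A < 1 →
        BilinearObs.specRadius A < ENNReal.ofReal ρ → ρ < 1 →
      ∀ (u : ℕ → Fin p → ℝ) (β : ℝ), 0 < β →
        (∀ t ≤ T, BilinearObs.euclNorm (u t) ≤ β) →
        (BilinearObs.designGram u L T).PosDef →
      ∀ (Ω : Type*) [MeasurableSpace Ω] (P : Measure Ω) [IsProbabilityMeasure P]
        (w : ℕ → Ω → Fin n → ℝ) (z : ℕ → Ω → ℝ)
        (S : Matrix (Fin n) (Fin n) ℝ) (σz : ℝ),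
        BilinearObs.IsProcessNoise P T w S →
        BilinearObs.IsMeasurementNoise P T z σz →
      ∀ (Ghat : Ω → Matrix (Fin p) (Fin L × Fin p) ℝ),
        (∀ ω, BilinearObs.IsLeastSquares u
          (BilinearObs.output A B C u (fun t => w t ω) (fun t => z t ω)) L T (Ghat ω)) →
      ∀ δ : ℝ, 0 < δ → δ < 1 →
        ENNReal.ofReal (1 - δ) ≤
          P {ω | BilinearObs.ellNorm (BilinearObs.designGram u L T)
                (Matrix.vec (Ghat ω) - Matrix.vec (BilinearObs.markovG A B C L)) ≤
              c * BilinearObs.errorBound A B C S σz β ρ δ L T} ∧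
        ENNReal.ofReal (1 - δ) ≤
          P {ω | BilinearObs.frobNorm (Ghat ω - BilinearObs.markovG A B C L) ≤
              c * (BilinearObs.errorBound A B C S σz β ρ δ L T /
                Real.sqrt (BilinearObs.lambdaMin (BilinearObs.designGram u L T)))} := by
  refine ⟨3, by norm_num, ?_⟩
  intro n p L T _ hLT A B C ρ _ hρA hρ1 u β hβ hu hV Ω _ P _ w z S σz hw hz Ghat hG δ hδ _
  have hprob := BilinearObs.ofReal_one_sub_le_measure_norm_projection (C := C) B hρA hρ1 hLT.le
    hβ.le hu hw hz hδ
  have hell := fun ω => BilinearObs.ellNorm_vec_sub_le (S := S) (σz := σz) (δ := δ) hρA hρ1 hLT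
    hβ.le hu (hG ω)
  -- Both bounds hold on one event defined through the noise alone, so monotonicity of the measure
  -- suffices without measurability of `Ghat`.
  refine ⟨hprob.trans (measure_mono fun ω hω => hell ω hω),
    hprob.trans (measure_mono fun ω hω => ?_)⟩
  rw [Set.mem_ofPred_eq, ← mul_div_assoc]
  exact BilinearObs.frobNorm_sub_le_of_ellNorm_le hV (hell ω hω)
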